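/- Let $(\Omega,\mathcal F,P)$ be a probability space with a filtration $\mathcal F_1\subset\mathcal F_2\subset\dots\subset\mathcal F$ such that $\sigma(\bigcup_{k\ge1}\mathcal F_k)=\mathcal F$. All functions are scalar-valued, with real or complex scalars. For $f\in L^1(\Omega)$ put $f_k=\mathbb E(f\mid\mathcal F_k)$ for $k\ge1$, $f_0=0$ and $d_kf=f_k-f_{k-1}$. For a martingale $M=(M_k)_{k\ge1}$ of integrable random variables put $M_0=0$, $d_kM=M_k-M_{k-1}$ and $S(M)=\big(\sum_{k\ge1}|d_kM|^2\big)^{1/2}$; for $f\in L^1(\Omega)$, $S(f)$ is the square function of $(f_k)_{k\ge1}$. Let $\Phi(t)=t/\log(e+t)$, $t\ge0$, and define - $H^1(\Omega)=\{f\in L^1(\Omega):\|f\|_{H^1}:=\|S(f)\|_1<\infty\}$; - $BMO(\Omega)=\{g\in L^2(\Omega):\|g\|_{BMO}:=\sup_{k\ge1}\|\mathbb E(|g-g_{k-1}|^2\mid\mathcal F_k)\|_\infty^{1/2}<\infty\}$; - $L^\Phi(\Omega)$, the space of the measurable $h$ with $\int_\Omega\Phi(|h|/\lambda)\,dP<\infty$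 for some $\lambda>0$, with the quasi-norm $\|h\|_{L^\Phi}=\inf\{\lambda>0:\int_\Omega\Phi(|h|/\lambda)\,dP\le1\}$; - $H^\Phi(\Omega)$, the space of all martingales $M=(M_k)_{k\ge1}$ of integrable random variables with $S(M)\in L^\Phi(\Omega)$, with the quasi-norm $\|M\|_{H^\Phi}=\|S(M)\|_{L^\Phi}$. There are continuous bilinear operators $\Pi_1:H^1(\Omega)\times BMO(\Omega)\to L^1(\Omega)$, $\Pi_2:H^1(\Omega)\times BMO(\Omega)\to H^1(\Omega)$ and $\Pi_3:H^1(\Omega)\times BMO(\Omega)\to H^\Phi(\Omega)$; more precisely, with an absolute constant $C$, $$\|\Pi_1(f,g)\|_{1},\ \ \|\Pi_2(f,g)\|_{H^1},\ \ \|\Pi_3(f,g)\|_{H^\Phi}\ \le\ C\,\|f\|_{H^1}\|g\|_{BMO}\qquad(f\in H^1(\Omega),\ g\in BMO(\Omega)).$$ They are given by $$\Pi_1(f,g)=\sum_{k\ge1}d_kf\,d_kg,\qquad \Pi_2(f,g)=\sum_{k\ge1}f_{k-1}\,d_kg,\qquad \Pi_3(f,g)=\sum_{k\ge1}g_{k-1}\,d_kf,$$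 where the three series converge almost everywhere, and $\Pi_3(f,g)$, as an element of $H^\Phi(\Omega)$, is the martingale of the partial sums of the third series. With the almost everywhere sums of the series, the pointwise product satisfies $$f\cdot g=\Pi_1(f,g)+\Pi_2(f,g)+\Pi_3(f,g)\quad\text{almost everywhere}$$ for all $f\in H^1(\Omega)$ and $g\in BMO(\Omega)$. -/

import Mathlib

open MeasureTheory Filter Topology
open scoped ENNReal NNReal

namespace MartingaleHardy

/-! ### Martingale sequences

The `σ`-algebra `F_k`, `k ≥ 1`, of a filtration `F_1 ⊆ F_2 ⊆ …` is `ℱ (k - 1)` for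
`ℱ : Filtration ℕ mΩ`. Accordingly the term of index `n` of a sequence below is the one which is
usually numbered `n + 1`, and the conventional value `f_0 = 0` appears through `prev`. -/

/-- The preceding term of a sequence, where the term that precedes the first one is `0`. -/
def prev {β : Type*} [Zero β] (X : ℕ → β) : ℕ → β
  | 0 => 0
  | n + 1 => X n

section Sequences

variable {Ω 𝕜 : Type*} [RCLike 𝕜]

/-- The differences `d_k X = X_k - X_{k-1}`, `k ≥ 1`, with `X_0 = 0`. -/
def diff (X : ℕ → Ω → 𝕜) (n : ℕ) : Ω → 𝕜 := X n - prev X n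

/-- The square function `S(X) = (∑_k |d_k X|²)^{1/2}`, with values in `[0, ∞]`. -/
noncomputable def squareFn (X : ℕ → Ω → 𝕜) (ω : Ω) : ℝ≥0∞ :=
  (∑' n, ‖diff X n ω‖ₑ ^ 2) ^ (1 / 2 : ℝ)

/-- The sequence `f_k = E(f | F_k)`, `k ≥ 1`. -/
noncomputable def condSeq {mΩ : MeasurableSpace Ω} (ℱ : Filtration ℕ mΩ) (P : Measure Ω)
    (f : Ω → 𝕜) (n : ℕ) : Ω → 𝕜 := P[f | ℱ n]

theorem diff_apply (X : ℕ → Ω → 𝕜) (n : ℕ) (ω : Ω) :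
    diff X n ω = X n ω - prev (fun k => X k ω) n := by
  cases n <;> rfl

theorem squareFn_congr {X Y : ℕ → Ω → 𝕜} {ω : Ω} (h : ∀ n, X n ω = Y n ω) :
    squareFn X ω = squareFn Y ω := by
  simp only [squareFn, diff_apply, h]

theorem squareFn_add_le (X Y : ℕ → Ω → 𝕜) (ω : Ω) :
    squareFn (fun n => X n + Y n) ω ≤ squareFn X ω + squareFn Y ω := by
  have h := ENNReal.lintegral_Lp_add_le (μ := Measure.count) (p := 2)
    (f := fun n => ‖diff X n ω‖ₑ) (g := fun n => ‖diff Y n ω‖ₑ)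
    measurable_from_nat.aemeasurable measurable_from_nat.aemeasurable one_le_two
  simp only [lintegral_count, Pi.add_apply, ENNReal.rpow_two] at h
  refine le_trans ?_ h
  unfold squareFn
  gcongr with n
  have : diff (fun n => X n + Y n) n ω = diff X n ω + diff Y n ω := by
    cases n with
    | zero => simp [diff, prev]
    | succ n => simp only [diff, prev, Pi.sub_apply, Pi.add_apply]; ring
  rw [this]
  exact enorm_add_le _ _

theorem squareFn_smul (c : 𝕜) (X : ℕ → Ω → 𝕜) (ω : Ω) :
    squareFn (fun n => c • X n) ω = ‖c‖ₑ * squareFn X ω := by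
  have (n : ℕ) : diff (fun n => c • X n) n ω = c * diff X n ω := by
    cases n <;> simp [diff, prev]
    ring
  simp only [squareFn, this, enorm_mul, mul_pow, ENNReal.tsum_mul_left]
  rw [ENNReal.mul_rpow_of_nonneg _ _ (by norm_num), ← ENNReal.rpow_two, ← ENNReal.rpow_mul]
  norm_num

theorem squareFn_zero (ω : Ω) : squareFn (fun _ => (0 : Ω → 𝕜)) ω = 0 := by
  have (n : ℕ) : diff (fun _ => (0 : Ω → 𝕜)) n ω = 0 := by
    cases n <;> simp [diff, prev]
  simp [squareFn, this]

theorem aemeasurable_squareFn {mΩ : MeasurableSpace Ω} {P : Measure Ω} {X : ℕ → Ω → 𝕜}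
    (h : ∀ n, AEStronglyMeasurable (X n) P) : AEMeasurable (squareFn X) P := by
  have hd (n : ℕ) : AEStronglyMeasurable (diff X n) P := by
    cases n with
    | zero => exact (h 0).sub aestronglyMeasurable_const
    | succ n => exact (h (n + 1)).sub (h n)
  exact (AEMeasurable.tsum fun n => (hd n).enorm.pow_const 2).pow_const _

end Sequences

/-! ### The Orlicz space `L^Φ` -/

/-- The Orlicz function `Φ(t) = t / log (e + t)`, `t ≥ 0`. -/
noncomputable def Phi (t : ℝ) : ℝ := t / Real.log (Real.exp 1 + t)

/-- `Φ` on `[0, ∞]`, with `Φ(∞) = ∞`. -/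
noncomputable def ePhi (t : ℝ≥0∞) : ℝ≥0∞ := if t = ∞ then ∞ else ENNReal.ofReal (Phi t.toReal)

theorem Phi_le_Phi {s t : ℝ} (hs : 0 ≤ s) (hst : s ≤ t) : Phi s ≤ Phi t := by
  have he : (2 : ℝ) < Real.exp 1 := by linarith [Real.exp_one_gt_d9]
  have hpos {u : ℝ} (hu : 0 ≤ u) : 1 ≤ Real.log (Real.exp 1 + u) := by
    rw [Real.le_log_iff_exp_le (by linarith)]; linarith
  rcases hs.eq_or_lt with rfl | hs'
  · simp only [Phi, zero_div]
    exact div_nonneg hst (by linarith [hpos hst])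
  have ht : 0 < t := hs'.trans_le hst
  have hm1 : Real.exp 1 ∈ Set.Ioi (0 : ℝ) := Set.mem_Ioi.2 (by linarith)
  have hm2 : Real.exp 1 + t ∈ Set.Ioi (0 : ℝ) := Set.mem_Ioi.2 (by linarith)
  have hab : 0 ≤ 1 - s / t := by rw [sub_nonneg, div_le_one ht]; exact hst
  have hc := strictConcaveOn_log_Ioi.concaveOn.2 hm1 hm2 hab
    (show 0 ≤ s / t by positivity) (by ring)
  have e : (1 - s / t) • Real.exp 1 + (s / t) • (Real.exp 1 + t) = Real.exp 1 + s := by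
    simp only [smul_eq_mul]; field_simp; ring
  rw [e] at hc
  simp only [smul_eq_mul, Real.log_exp, mul_one] at hc
  have h2 : s / t * Real.log (Real.exp 1 + t) ≤ Real.log (Real.exp 1 + s) := by linarith
  unfold Phi
  rw [div_le_div_iff₀ (by linarith [hpos hs]) (by linarith [hpos ht.le])]
  calc s * Real.log (Real.exp 1 + t) = t * (s / t * Real.log (Real.exp 1 + t)) := by
        field_simp
    _ ≤ t * Real.log (Real.exp 1 + s) := by gcongr

theorem ePhi_mono : Monotone ePhi := by
  intro s t hst
  unfold ePhi
  by_cases ht : t = ∞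
  · simp [ht]
  · have hs : s ≠ ∞ := ne_top_of_le_ne_top ht hst
    rw [if_neg hs, if_neg ht]
    exact ENNReal.ofReal_le_ofReal
      (Phi_le_Phi ENNReal.toReal_nonneg (ENNReal.toReal_mono ht hst))

section Orlicz

variable {Ω : Type*} {mΩ : MeasurableSpace Ω}

/-- Membership of a nonnegative, possibly infinite, function in the Orlicz space `L^Φ(P)`. -/
def MemLPhi (P : Measure Ω) (F : Ω → ℝ≥0∞) : Prop :=
  AEMeasurable F P ∧ ∃ l : ℝ≥0, 0 < l ∧ ∫⁻ ω, ePhi (F ω / l) ∂P < ∞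

/-- The Luxemburg quasi-norm of `L^Φ(P)` (the infimum of the empty set is `∞`). -/
noncomputable def lPhiNorm (P : Measure Ω) (F : Ω → ℝ≥0∞) : ℝ≥0∞ :=
  ⨅ (l : ℝ≥0) (_ : 0 < l ∧ ∫⁻ ω, ePhi (F ω / l) ∂P ≤ 1), (l : ℝ≥0∞)

theorem MemLPhi.mono {P : Measure Ω} {F G : Ω → ℝ≥0∞} (hG : MemLPhi P G)
    (hF : AEMeasurable F P) (h : ∀ᵐ ω ∂P, F ω ≤ G ω) : MemLPhi P F := by
  obtain ⟨_, l, hl, hi⟩ := hG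
  refine ⟨hF, l, hl, lt_of_le_of_lt (lintegral_mono_ae ?_) hi⟩
  filter_upwards [h] with ω hω
  exact ePhi_mono (ENNReal.div_le_div_right hω _)

theorem MemLPhi.add {P : Measure Ω} {F G : Ω → ℝ≥0∞} (hF : MemLPhi P F) (hG : MemLPhi P G) :
    MemLPhi P (fun ω => F ω + G ω) := by
  obtain ⟨mF, l, hl, hi⟩ := hF
  obtain ⟨mG, k, hk, hj⟩ := hG
  refine ⟨mF.add mG, l + k, by positivity, lt_of_le_of_lt ?_ (ENNReal.add_lt_top.2 ⟨hi, hj⟩)⟩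
  have mF' : AEMeasurable (fun ω => ePhi (F ω / l)) P :=
    ePhi_mono.measurable.comp_aemeasurable (mF.div_const _)
  rw [← lintegral_add_left' mF']
  refine lintegral_mono fun ω => ?_
  have hl' : (l : ℝ≥0∞) ≠ 0 := by exact_mod_cast hl.ne'
  have hk' : (k : ℝ≥0∞) ≠ 0 := by exact_mod_cast hk.ne'
  have key : (F ω + G ω) / ((l + k : ℝ≥0) : ℝ≥0∞) ≤ max (F ω / l) (G ω / k) := by
    apply ENNReal.div_le_of_le_mul
    push_cast
    rw [mul_add]
    gcongr
    · calc F ω = F ω / l * l := (ENNReal.div_mul_cancel hl' ENNReal.coe_ne_top).symm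
        _ ≤ _ := by gcongr; exact le_max_left _ _
    · calc G ω = G ω / k * k := (ENNReal.div_mul_cancel hk' ENNReal.coe_ne_top).symm
        _ ≤ _ := by gcongr; exact le_max_right _ _
  refine (ePhi_mono key).trans ?_
  rw [ePhi_mono.map_max]
  exact max_le le_self_add le_add_self

theorem MemLPhi.const_mul {P : Measure Ω} {F : Ω → ℝ≥0∞} (hF : MemLPhi P F) (c : ℝ≥0) :
    MemLPhi P (fun ω => c * F ω) := by
  obtain ⟨mF, l, hl, hi⟩ := hF
  refine ⟨mF.const_mul _, (c + 1) * l, by positivity, lt_of_le_of_lt (lintegral_mono fun ω => ?_) hi⟩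
  apply ePhi_mono
  have hl' : (l : ℝ≥0∞) ≠ 0 := by exact_mod_cast hl.ne'
  apply ENNReal.div_le_of_le_mul
  push_cast
  calc (c : ℝ≥0∞) * F ω ≤ (c + 1) * F ω := by gcongr; exact le_self_add
    _ = (c + 1) * (F ω / l * l) := by rw [ENNReal.div_mul_cancel hl' ENNReal.coe_ne_top]
    _ = F ω / l * ((c + 1) * l) := by ring

theorem memLPhi_zero (P : Measure Ω) : MemLPhi P (fun _ => 0) :=
  ⟨aemeasurable_const, 1, one_pos, by simp [ePhi, Phi]⟩

end Orlicz

/-! ### The spaces `H^1`, `BMO` and `H^Φ` -/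

section Spaces

variable {Ω : Type*} {mΩ : MeasurableSpace Ω} (𝕜 : Type*) [RCLike 𝕜]
  (ℱ : Filtration ℕ mΩ) (P : Measure Ω)

variable {𝕜} in
/-- `‖f‖_{H^1} = ‖S(f)‖_1`. -/
noncomputable def h1Norm (f : Ω → 𝕜) : ℝ≥0∞ := ∫⁻ ω, squareFn (condSeq ℱ P f) ω ∂P

variable {𝕜} in
/-- `‖f‖_{BMO} = sup_{k ≥ 1} ‖E_k |f - f_{k-1}|²‖_∞^{1/2}`. -/
noncomputable def bmoNorm (f : Ω → 𝕜) : ℝ≥0∞ :=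
  ⨆ n : ℕ, (eLpNorm (P[fun ω => ‖f ω - prev (condSeq ℱ P f) n ω‖ ^ 2 | ℱ n]) ∞ P) ^ (1 / 2 : ℝ)

variable {𝕜} in
/-- `‖M‖_{H^Φ} = ‖S(M)‖_{L^Φ}` for a sequence `M` of random variables. -/
noncomputable def hPhiNorm (M : ℕ → Ω → 𝕜) : ℝ≥0∞ := lPhiNorm P (squareFn M)

variable {𝕜 ℱ P} in
theorem memLp_sub_prev {f : Ω → 𝕜} (hf : MemLp f 2 P) (n : ℕ) :
    MemLp (fun ω => f ω - prev (condSeq ℱ P f) n ω) 2 P := by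
  cases n with
  | zero => exact hf.sub MemLp.zero
  | succ n => exact hf.sub (hf.condExp one_le_two)

variable {𝕜 ℱ P} in
theorem bmoNorm_lt_top_of_le {f : Ω → 𝕜} {C : ℝ≥0∞} (hC : C < ∞)
    (h : ∀ n, eLpNorm (P[fun ω => ‖f ω - prev (condSeq ℱ P f) n ω‖ ^ 2 | ℱ n]) ∞ P ≤ C) :
    bmoNorm ℱ P f < ∞ := by
  refine lt_of_le_of_lt (iSup_le fun n => ENNReal.rpow_le_rpow (h n) (by norm_num)) ?_
  exact ENNReal.rpow_lt_top_of_nonneg (by norm_num) hC.ne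

variable {𝕜 ℱ P} in
theorem le_bmoNorm_sq (f : Ω → 𝕜) (n : ℕ) :
    eLpNorm (P[fun ω => ‖f ω - prev (condSeq ℱ P f) n ω‖ ^ 2 | ℱ n]) ∞ P ≤
      (bmoNorm ℱ P f) ^ 2 := by
  have h := le_iSup (fun n : ℕ =>
    (eLpNorm (P[fun ω => ‖f ω - prev (condSeq ℱ P f) n ω‖ ^ 2 | ℱ n]) ∞ P) ^ (1 / 2 : ℝ)) n
  calc _ = ((eLpNorm (P[fun ω => ‖f ω - prev (condSeq ℱ P f) n ω‖ ^ 2 | ℱ n]) ∞ P) ^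
        (1 / 2 : ℝ)) ^ 2 := by
        rw [← ENNReal.rpow_two, ← ENNReal.rpow_mul]; norm_num
    _ ≤ _ := by gcongr; exact h

variable [IsProbabilityMeasure P]

/-- The martingale Hardy space `H^1`: the (classes of) `f ∈ L^1` with `‖f‖_{H^1} < ∞`. -/
noncomputable def H1 : Submodule 𝕜 (Lp 𝕜 1 P) where
  carrier := {f | h1Norm ℱ P f < ∞}
  zero_mem' := by
    have h0 (n : ℕ) : condSeq ℱ P (0 : Lp 𝕜 1 P) n =ᵐ[P] 0 :=
      (condExp_congr_ae (Lp.coeFn_zero 𝕜 1 P)).trans (by rw [condExp_zero])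
    have : ∀ᵐ ω ∂P, squareFn (condSeq ℱ P (0 : Lp 𝕜 1 P)) ω = 0 := by
      filter_upwards [ae_all_iff.2 h0] with ω hω
      rw [squareFn_congr hω, squareFn_zero]
    change h1Norm ℱ P (0 : Lp 𝕜 1 P) < ∞
    rw [h1Norm, lintegral_congr_ae this, lintegral_zero]
    exact ENNReal.zero_lt_top
  add_mem' := by
    intro f g hf hg
    have hfi : Integrable f P := memLp_one_iff_integrable.1 (Lp.memLp f)
    have hgi : Integrable g P := memLp_one_iff_integrable.1 (Lp.memLp g)
    have h0 (n : ℕ) : condSeq ℱ P (f + g : Lp 𝕜 1 P) n =ᵐ[P] condSeq ℱ P f n + condSeq ℱ P g n :=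
      (condExp_congr_ae (Lp.coeFn_add f g)).trans (condExp_add hfi hgi _)
    have hm : AEMeasurable (squareFn (condSeq ℱ P f)) P :=
      aemeasurable_squareFn fun n => integrable_condExp.aestronglyMeasurable
    have : ∀ᵐ ω ∂P, squareFn (condSeq ℱ P (f + g : Lp 𝕜 1 P)) ω ≤
        squareFn (condSeq ℱ P f) ω + squareFn (condSeq ℱ P g) ω := by
      filter_upwards [ae_all_iff.2 h0] with ω hω
      rw [squareFn_congr (Y := fun n => condSeq ℱ P f n + condSeq ℱ P g n) hω]
      exact squareFn_add_le _ _ _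
    refine lt_of_le_of_lt (lintegral_mono_ae this) ?_
    rw [lintegral_add_left' hm]
    exact ENNReal.add_lt_top.2 ⟨hf, hg⟩
  smul_mem' := by
    intro c f hf
    have h0 (n : ℕ) : condSeq ℱ P (c • f : Lp 𝕜 1 P) n =ᵐ[P] c • condSeq ℱ P f n :=
      (condExp_congr_ae (Lp.coeFn_smul c f)).trans (condExp_smul c _ _)
    have : ∀ᵐ ω ∂P, squareFn (condSeq ℱ P (c • f : Lp 𝕜 1 P)) ω =
        ‖c‖ₑ * squareFn (condSeq ℱ P f) ω := by
      filter_upwards [ae_all_iff.2 h0] with ω hω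
      rw [squareFn_congr (Y := fun n => c • condSeq ℱ P f n) hω, squareFn_smul]
    change h1Norm ℱ P _ < ∞
    rw [h1Norm, lintegral_congr_ae this, lintegral_const_mul' _ _ enorm_ne_top]
    exact ENNReal.mul_lt_top enorm_lt_top hf

/-- The space `BMO`: the (classes of) `f ∈ L^2` with `‖f‖_{BMO} < ∞`. -/
noncomputable def BMO : Submodule 𝕜 (Lp 𝕜 2 P) where
  carrier := {f | bmoNorm ℱ P f < ∞}
  zero_mem' := by
    refine bmoNorm_lt_top_of_le (C := 0) (by simp) fun n => ?_
    have h0 (n : ℕ) : condSeq ℱ P (0 : Lp 𝕜 2 P) n =ᵐ[P] 0 :=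
      (condExp_congr_ae (Lp.coeFn_zero 𝕜 2 P)).trans (by rw [condExp_zero])
    have h1 : (fun ω => ‖(0 : Lp 𝕜 2 P) ω - prev (condSeq ℱ P (0 : Lp 𝕜 2 P)) n ω‖ ^ 2)
        =ᵐ[P] 0 := by
      filter_upwards [Lp.coeFn_zero 𝕜 2 P, ae_all_iff.2 h0] with ω h2 h3
      cases n with
      | zero => simp only [prev, Pi.zero_apply, h2]; simp
      | succ n => simp only [prev, h2, h3 n]; simp
    rw [eLpNorm_congr_ae (condExp_congr_ae h1), condExp_zero]
    simp
  add_mem' := by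
    intro f g hf hg
    refine bmoNorm_lt_top_of_le
      (C := 2 * bmoNorm ℱ P f ^ 2 + 2 * bmoNorm ℱ P g ^ 2) ?_ fun n => ?_
    · exact ENNReal.add_lt_top.2 ⟨ENNReal.mul_lt_top (by simp) (ENNReal.pow_lt_top hf),
        ENNReal.mul_lt_top (by simp) (ENNReal.pow_lt_top hg)⟩
    have hfi : Integrable f P := (Lp.memLp f).integrable one_le_two
    have hgi : Integrable g P := (Lp.memLp g).integrable one_le_two
    have h0 (k : ℕ) : condSeq ℱ P (f + g : Lp 𝕜 2 P) k =ᵐ[P] condSeq ℱ P f k + condSeq ℱ P g k :=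
      (condExp_congr_ae (Lp.coeFn_add f g)).trans (condExp_add hfi hgi _)
    set u : Ω → ℝ := fun ω => ‖f ω - prev (condSeq ℱ P f) n ω‖ ^ 2 with hu
    set v : Ω → ℝ := fun ω => ‖g ω - prev (condSeq ℱ P g) n ω‖ ^ 2 with hv
    set w : Ω → ℝ := fun ω => ‖(f + g : Lp 𝕜 2 P) ω -
      prev (condSeq ℱ P (f + g : Lp 𝕜 2 P)) n ω‖ ^ 2 with hw
    have hui : Integrable u P := (memLp_sub_prev (Lp.memLp f) n).integrable_norm_pow two_ne_zero
    have hvi : Integrable v P := (memLp_sub_prev (Lp.memLp g) n).integrable_norm_pow two_ne_zero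
    have hwi : Integrable w P :=
      (memLp_sub_prev (Lp.memLp (f + g)) n).integrable_norm_pow two_ne_zero
    have hle : w ≤ᵐ[P] (2 : ℝ) • u + (2 : ℝ) • v := by
      filter_upwards [Lp.coeFn_add f g, ae_all_iff.2 h0] with ω h1 h2
      have h3 : (f + g : Lp 𝕜 2 P) ω - prev (condSeq ℱ P (f + g : Lp 𝕜 2 P)) n ω =
          (f ω - prev (condSeq ℱ P f) n ω) + (g ω - prev (condSeq ℱ P g) n ω) := by
        cases n with
        | zero => simp only [prev, h1, Pi.add_apply, Pi.zero_apply]; ring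
        | succ n => simp only [prev, h1, h2 n, Pi.add_apply]; ring
      simp only [hw, h3, hu, hv, Pi.add_apply, Pi.smul_apply, smul_eq_mul]
      have h4 := norm_add_le (f ω - prev (condSeq ℱ P f) n ω) (g ω - prev (condSeq ℱ P g) n ω)
      have h5 := norm_nonneg (f ω - prev (condSeq ℱ P f) n ω + (g ω - prev (condSeq ℱ P g) n ω))
      nlinarith [sq_nonneg (‖f ω - prev (condSeq ℱ P f) n ω‖ - ‖g ω - prev (condSeq ℱ P g) n ω‖)]
    have hlin : P[(2 : ℝ) • u + (2 : ℝ) • v | ℱ n] =ᵐ[P]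
        (2 : ℝ) • P[u | ℱ n] + (2 : ℝ) • P[v | ℱ n] :=
      (condExp_add (hui.smul _) (hvi.smul _) _).trans
        ((condExp_smul _ _ _).add (condExp_smul _ _ _))
    have hmono := condExp_mono (m := ℱ n) hwi ((hui.smul (2 : ℝ)).add (hvi.smul (2 : ℝ))) hle
    have hnn : 0 ≤ᵐ[P] P[w | ℱ n] := condExp_nonneg (ae_of_all _ fun ω => by positivity)
    have e2 : ‖(2 : ℝ)‖ₑ = 2 := by rw [Real.enorm_eq_ofReal zero_le_two]; simp
    calc eLpNorm (P[w | ℱ n]) ∞ P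
        ≤ eLpNorm ((2 : ℝ) • P[u | ℱ n] + (2 : ℝ) • P[v | ℱ n]) ∞ P := by
          refine eLpNorm_mono_ae ?_
          filter_upwards [hlin, hmono, hnn] with ω a b c
          rw [Real.norm_of_nonneg c]
          exact (b.trans a.le).trans (Real.le_norm_self _)
      _ ≤ eLpNorm ((2 : ℝ) • P[u | ℱ n]) ∞ P + eLpNorm ((2 : ℝ) • P[v | ℱ n]) ∞ P :=
          eLpNorm_add_le (integrable_condExp.aestronglyMeasurable.const_smul _)
            (integrable_condExp.aestronglyMeasurable.const_smul _) le_top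
      _ ≤ 2 * bmoNorm ℱ P f ^ 2 + 2 * bmoNorm ℱ P g ^ 2 := by
          rw [eLpNorm_const_smul, eLpNorm_const_smul, e2]
          gcongr
          · exact le_bmoNorm_sq _ n
          · exact le_bmoNorm_sq _ n
  smul_mem' := by
    intro c f hf
    refine bmoNorm_lt_top_of_le (C := ‖‖c‖ ^ 2‖ₑ * bmoNorm ℱ P f ^ 2) ?_ fun n => ?_
    · exact ENNReal.mul_lt_top enorm_lt_top (ENNReal.pow_lt_top hf)
    have h0 (k : ℕ) : condSeq ℱ P (c • f : Lp 𝕜 2 P) k =ᵐ[P] c • condSeq ℱ P f k :=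
      (condExp_congr_ae (Lp.coeFn_smul c f)).trans (condExp_smul c _ _)
    have h1 : (fun ω => ‖(c • f : Lp 𝕜 2 P) ω - prev (condSeq ℱ P (c • f : Lp 𝕜 2 P)) n ω‖ ^ 2)
        =ᵐ[P] (‖c‖ ^ 2) • fun ω => ‖f ω - prev (condSeq ℱ P f) n ω‖ ^ 2 := by
      filter_upwards [Lp.coeFn_smul c f, ae_all_iff.2 h0] with ω h1 h2
      have h3 : (c • f : Lp 𝕜 2 P) ω - prev (condSeq ℱ P (c • f : Lp 𝕜 2 P)) n ω =
          c * (f ω - prev (condSeq ℱ P f) n ω) := by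
        cases n with
        | zero => simp only [prev, h1, Pi.smul_apply, Pi.zero_apply, smul_eq_mul]; ring
        | succ n => simp only [prev, h1, h2 n, Pi.smul_apply, smul_eq_mul]; ring
      rw [h3, norm_mul, mul_pow]
      rfl
    rw [eLpNorm_congr_ae ((condExp_congr_ae h1).trans (condExp_smul _ _ _)), eLpNorm_const_smul]
    gcongr
    exact le_bmoNorm_sq _ n

/-- The martingale Hardy--Orlicz space `H^Φ`: all martingales `M = (M_k)_{k ≥ 1}` of (classes of)
integrable random variables with `S(M) ∈ L^Φ`. -/
noncomputable def HPhi : Submodule 𝕜 (ℕ → Lp 𝕜 1 P) where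
  carrier := {M | (∀ i j, i ≤ j → P[M j | ℱ i] =ᵐ[P] M i) ∧
    MemLPhi P (squareFn fun n => (M n : Ω → 𝕜))}
  zero_mem' := by
    refine ⟨fun i j _ => ?_, ?_⟩
    · exact (condExp_congr_ae (Lp.coeFn_zero 𝕜 1 P)).trans
        (by rw [condExp_zero]; exact (Lp.coeFn_zero 𝕜 1 P).symm)
    · refine (memLPhi_zero P).mono
        (aemeasurable_squareFn fun n => Lp.aestronglyMeasurable _) ?_
      filter_upwards [Lp.coeFn_zero 𝕜 1 P] with ω hω
      have h0 (n : ℕ) : ((0 : ℕ → Lp 𝕜 1 P) n : Ω → 𝕜) ω = (fun _ : ℕ => (0 : Ω → 𝕜)) n ω := hω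
      rw [squareFn_congr h0, squareFn_zero]
  add_mem' := by
    rintro M N ⟨hM, hM'⟩ ⟨hN, hN'⟩
    refine ⟨fun i j hij => ?_, ?_⟩
    · have hMi : Integrable (M j) P := memLp_one_iff_integrable.1 (Lp.memLp _)
      have hNi : Integrable (N j) P := memLp_one_iff_integrable.1 (Lp.memLp _)
      exact ((condExp_congr_ae (Lp.coeFn_add (M j) (N j))).trans (condExp_add hMi hNi _)).trans
        (((hM i j hij).add (hN i j hij)).trans (Lp.coeFn_add (M i) (N i)).symm)
    · refine (hM'.add hN').mono (aemeasurable_squareFn fun n => Lp.aestronglyMeasurable _) ?_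
      filter_upwards [ae_all_iff.2 fun n => Lp.coeFn_add (M n) (N n)] with ω hω
      have h0 (n : ℕ) : ((M + N) n : Ω → 𝕜) ω =
          (fun n => (M n : Ω → 𝕜) + (N n : Ω → 𝕜)) n ω := hω n
      rw [squareFn_congr h0]
      exact squareFn_add_le _ _ _
  smul_mem' := by
    rintro c M ⟨hM, hM'⟩
    refine ⟨fun i j hij => ?_, ?_⟩
    · exact ((condExp_congr_ae (Lp.coeFn_smul c (M j))).trans (condExp_smul c _ _)).trans
        (((hM i j hij).const_smul c).trans (Lp.coeFn_smul c (M i)).symm)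
    · refine (hM'.const_mul ‖c‖₊).mono
        (aemeasurable_squareFn fun n => Lp.aestronglyMeasurable _) ?_
      filter_upwards [ae_all_iff.2 fun n => Lp.coeFn_smul c (M n)] with ω hω
      have h0 (n : ℕ) : ((c • M) n : Ω → 𝕜) ω = (fun n => c • (M n : Ω → 𝕜)) n ω := hω n
      rw [squareFn_congr h0, squareFn_smul]
      rfl

end Spaces

end MartingaleHardy

/-!
With `f_k = E(f | F_k)` and `g_k = E(g | F_k)`, summation by parts gives
`f_n g_n = ∑_{k ≤ n} (d_k f d_k g + f_{k-1} d_k g + g_{k-1} d_k f)`, and `f_n g_n → f g` almost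
everywhere by Lévy's upward theorem. So the decomposition of the product, and the convergence of the
third series, follow from the convergence of the first two; what remains is one estimate for each
product.

* The first series converges absolutely by Fefferman's inequality
  `E ∑ |d_k f| |d_k g| ≤ 2 ‖f‖_{H^1} ‖g‖_{BMO}` (`lintegral_tsum_diff_mul_diff_le`). With the partial
  square functions `S_k` of `f`, one splits `|d_k f| |d_k g| ≤ b (S_k - S_{k-1}) + b⁻¹ S_k |d_k g|²`;
  the first part telescopes. The second part is controlled by the weighted `BMO` inequality
  `E ∑ W_k |d_k g|² ≤ ‖g‖²_{BMO} E sup_k W_k` for increasing adapted weights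
  (`lintegral_tsum_mul_diff_le`), a consequence of the orthogonality of martingale differences.

* For the second series, the same weighted inequality with `W_k = max_{j ≤ k} |f_j|` bounds the
  square function by the maximal function of `f` (`lintegral_squareFn_transform_le`), and Davis'
  inequality `E sup |X_n| ≤ 24 E S(X)` (`lintegral_iSup_enorm_le`) bounds the latter by
  `‖f‖_{H^1}`. Davis' inequality, applied to the transform as well, makes its maximal function
  integrable, so that it converges and is closed by its limit
  (`exists_tendsto_and_eq_condExp`). Davis' inequality itself is the expectation of a deterministic
  inequality for scalar sequences in the style of Beiglböck and Siorpaes (`partialSups_norm_le`),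
  proved with a potential function.

* The third martingale has square function at most `S(f) sup_k |g_k|`. The maximal function of `g`
  has an exponential tail by a John--Nirenberg argument (`measure_lt_iSup_condSeq_le`), and the
  inequality `Φ(s x) ≤ s + exp x 1_{x > 1}`, with `exp x` split into layers (`ePhi_mul_le`), turns the
  product of an `L^1` and an `exp L` function into one in `L^Φ`.
-/

namespace MartingaleHardy

/-! ### The pathwise Davis inequality -/

/-- One step of the pathwise Davis inequality. A sequence moves from `x` to `x + d`, with
`t = |x|`, `y = |x + d|`, `δ = |d|` and `c = Re (conj x * d)`; `q` is the quadratic variation and `m`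
the maximal modulus before the step. With `s = (q + m²)^{1/2}`, the potential
`(|x|² + q) / s + s - 24 q^{1/2}` increases by at most `2 c / s`. Here `s = 0` is allowed, where the
quotients by `s` are `0`. -/
theorem davis_potential_le {t y δ c q m : ℝ} (ht : 0 ≤ t) (hy : 0 ≤ y) (hδ : 0 ≤ δ) (hq : 0 ≤ q)
    (htm : t ≤ m) (hyt : y ≤ t + δ) (hc : |c| ≤ t * δ) (hyc : y ^ 2 = t ^ 2 + 2 * c + δ ^ 2) :
    (y ^ 2 + (q + δ ^ 2)) / √(q + δ ^ 2 + max m y ^ 2) + √(q + δ ^ 2 + max m y ^ 2) ≤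
      (t ^ 2 + q) / √(q + m ^ 2) + √(q + m ^ 2) + 2 * (c / √(q + m ^ 2)) +
        24 * (√(q + δ ^ 2) - √q) := by
  set M := max m y with hM
  set s := √(q + m ^ 2) with hs
  set s' := √(q + δ ^ 2 + M ^ 2) with hs'
  set r := √q with hr
  set r' := √(q + δ ^ 2) with hr'
  have hm : 0 ≤ m := ht.trans htm
  have sq_le {a b : ℝ} (hb : 0 ≤ b) (h : a ^ 2 ≤ b ^ 2) : a ≤ b :=
    le_of_abs_le (abs_le_of_sq_le_sq h hb)
  have hs0 : 0 ≤ s := Real.sqrt_nonneg _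
  have hs'0 : 0 ≤ s' := Real.sqrt_nonneg _
  have hr0 : 0 ≤ r := Real.sqrt_nonneg _
  have hr'0 : 0 ≤ r' := Real.sqrt_nonneg _
  have es : s ^ 2 = q + m ^ 2 := Real.sq_sqrt (by positivity)
  have es' : s' ^ 2 = q + δ ^ 2 + M ^ 2 := Real.sq_sqrt (by positivity)
  have er : r ^ 2 = q := Real.sq_sqrt hq
  have er' : r' ^ 2 = q + δ ^ 2 := Real.sq_sqrt (by positivity)
  have hmM : m ≤ M := le_max_left _ _
  have hyM : y ≤ M := le_max_right _ _
  have hMm : M ≤ m + δ := max_le (by linarith) (by linarith)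
  have hMsq : M ^ 2 ≤ (m + δ) ^ 2 := pow_le_pow_left₀ (hm.trans hmM) hMm 2
  have hysq : y ^ 2 ≤ M ^ 2 := pow_le_pow_left₀ hy hyM 2
  have hmsq : m ^ 2 ≤ M ^ 2 := pow_le_pow_left₀ hm hmM 2
  have hmδ := mul_nonneg hm hδ
  have hδ2 := sq_nonneg δ
  have hms : m ≤ s := sq_le hs0 (by linarith)
  have hrs : r ≤ s := sq_le hs0 (by linarith [sq_nonneg m])
  have hrr' : r ≤ r' := sq_le hr'0 (by linarith)
  have hr'r : r' ≤ r + δ := sq_le (by linarith) (by linarith [add_sq r δ, mul_nonneg hr0 hδ])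
  have hss : s' ≤ s + 2 * δ := sq_le (by linarith) (by
    linarith [add_sq s (2 * δ), add_sq m δ, mul_pow 2 δ 2, mul_le_mul_of_nonneg_right hms hδ])
  have hT : y ^ 2 + (q + δ ^ 2) ≤ s' ^ 2 := by linarith
  have hgain : δ ^ 2 ≤ (r' - r) * (2 * s + δ) := by
    calc δ ^ 2 = (r' - r) * (r + r') := by linarith [show (r' - r) * (r + r') = r' ^ 2 - r ^ 2 by ring]
      _ ≤ _ := mul_le_mul_of_nonneg_left (by linarith) (by linarith)
  rcases le_or_gt s δ with h | h
  · -- a large jump: every term is at most a multiple of `δ`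
    have h1 : δ / 3 ≤ r' - r := by
      rcases hδ.eq_or_lt with h0 | h0
      · rw [← h0]; linarith
      · have : δ * δ ≤ δ * (3 * (r' - r)) := by
          linarith [mul_le_mul_of_nonneg_left h (sub_nonneg.2 hrr')]
        linarith [le_of_mul_le_mul_left this h0]
    have h2 : (y ^ 2 + (q + δ ^ 2)) / s' ≤ s' := div_le_of_le_mul₀ hs'0 hs'0 (by linarith)
    have h3 : -δ ≤ c / s := by
      rcases hs0.eq_or_lt with h0 | h0
      · rw [← h0]; simpa using hδ
      · rw [le_div_iff₀ h0]
        linarith [(abs_le.1 hc).1, mul_le_mul_of_nonneg_right (htm.trans hms) hδ]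
    have h4 : 0 ≤ (t ^ 2 + q) / s := by positivity
    linarith
  · -- a small jump: the first order terms cancel
    have hsp : 0 < s := hδ.trans_lt h
    have h1 : δ ^ 2 / s ≤ 3 * (r' - r) := by
      rw [div_le_iff₀ hsp]
      linarith [mul_le_mul_of_nonneg_left h.le (sub_nonneg.2 hrr')]
    have hs's : s ≤ s' := sq_le hs'0 (by linarith)
    have hs'p : 0 < s' := hsp.trans_le hs's
    have h2 : (y ^ 2 + (q + δ ^ 2)) / s' + s' ≤ (y ^ 2 + (q + δ ^ 2)) / s + s + δ ^ 2 / s := by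
      rcases le_total m y with hmy | hmy
      · rw [max_eq_right hmy] at hM
        have e : y ^ 2 + (q + δ ^ 2) = s' ^ 2 := by rw [es', hM]; ring
        have e1 : s' ^ 2 / s' = s' := by field_simp
        have e2 : s' + s' ≤ s' ^ 2 / s + s := by
          rw [← sub_le_iff_le_add, le_div_iff₀ hsp]; linarith [sq_nonneg (s' - s), sub_sq s' s]
        rw [e, e1]
        have : 0 ≤ δ ^ 2 / s := by positivity
        linarith
      · rw [max_eq_left hmy] at hM
        have e : s' ≤ s + δ ^ 2 / s := by
          refine sq_le (by positivity) ?_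
          have : (s + δ ^ 2 / s) ^ 2 = s ^ 2 + 2 * δ ^ 2 + (δ ^ 2 / s) ^ 2 := by field_simp; ring
          rw [this, es', hM, es]; linarith [sq_nonneg (δ ^ 2 / s)]
        have e2 : (y ^ 2 + (q + δ ^ 2)) / s' ≤ (y ^ 2 + (q + δ ^ 2)) / s := by gcongr
        linarith
    have h3 : (y ^ 2 + (q + δ ^ 2)) / s = (t ^ 2 + q) / s + 2 * (c / s) + 2 * (δ ^ 2 / s) := by
      rw [hyc]; field_simp; ring
    linarith

section Pathwise

variable {𝕜 : Type*} [RCLike 𝕜]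

/-- The partial sums `∑_{k ≤ n} |x_k - x_{k-1}|²` of the quadratic variation of a sequence. -/
def quadVar (x : ℕ → 𝕜) (n : ℕ) : ℝ := ∑ k ∈ Finset.range (n + 1), ‖x k - prev x k‖ ^ 2

/-- The weights `x_n / ([x]_n + max_{k ≤ n} |x_k|²)^{1/2}` of the pathwise Davis inequality. -/
noncomputable def davisWeight (x : ℕ → 𝕜) (n : ℕ) : 𝕜 :=
  x n * ((√(quadVar x n + partialSups (fun k => ‖x k‖) n ^ 2))⁻¹ : ℝ)

theorem quadVar_nonneg (x : ℕ → 𝕜) (n : ℕ) : 0 ≤ quadVar x n := by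
  unfold quadVar; positivity

theorem norm_davisWeight_le (x : ℕ → 𝕜) (n : ℕ) : ‖davisWeight x n‖ ≤ 1 := by
  have h : ‖x n‖ ≤ √(quadVar x n + partialSups (fun k => ‖x k‖) n ^ 2) := by
    have h1 : ‖x n‖ ≤ partialSups (fun k => ‖x k‖) n :=
      le_partialSups (fun k => ‖x k‖) n
    refine Real.le_sqrt_of_sq_le ?_
    have := quadVar_nonneg x n
    nlinarith [norm_nonneg (x n)]
  rw [davisWeight, norm_mul, RCLike.norm_ofReal, abs_of_nonneg (by positivity), ← div_eq_mul_inv]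
  exact div_le_one_of_le₀ h (by positivity)

/-- The pathwise Davis inequality: the maximum of a sequence is bounded by its square function and
a transform of its differences with weights of modulus at most `1`. It sums
`davis_potential_le` over the steps. -/
theorem partialSups_norm_le (x : ℕ → 𝕜) (n : ℕ) :
    partialSups (fun k => ‖x k‖) n ≤ 24 * √(quadVar x n) +
      2 * RCLike.re (∑ k ∈ Finset.range (n + 1),
        prev (fun k => (starRingEnd 𝕜) (davisWeight x k)) k * (x k - prev x k)) := by
  -- the potential dominates `(q + m²)^{1/2} - 24 q^{1/2}`, and starts with a value `≤ 0`
  have key : (‖x n‖ ^ 2 + quadVar x n) / √(quadVar x n + partialSups (fun k => ‖x k‖) n ^ 2) +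
      √(quadVar x n + partialSups (fun k => ‖x k‖) n ^ 2) ≤ 24 * √(quadVar x n) +
      2 * RCLike.re (∑ k ∈ Finset.range (n + 1),
        prev (fun k => (starRingEnd 𝕜) (davisWeight x k)) k * (x k - prev x k)) := by
    induction n with
    | zero =>
      have h := davis_potential_le (t := 0) (y := ‖x 0‖) (δ := ‖x 0‖) (c := 0) (q := 0) (m := 0) le_rfl
        (norm_nonneg _) (norm_nonneg _) le_rfl le_rfl (by simp) (by simp) (by simp)
      simpa [quadVar, prev] using h
    | succ n ih =>
      have e : ‖x (n + 1)‖ ^ 2 = ‖x n‖ ^ 2 +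
          2 * RCLike.re ((starRingEnd 𝕜) (x n) * (x (n + 1) - x n)) + ‖x (n + 1) - x n‖ ^ 2 := by
        have := norm_add_sq (𝕜 := 𝕜) (x n) (x (n + 1) - x n)
        rw [add_sub_cancel] at this
        rw [this, RCLike.inner_apply, mul_comm (x (n + 1) - x n)]
      have h := davis_potential_le (t := ‖x n‖) (y := ‖x (n + 1)‖) (δ := ‖x (n + 1) - x n‖)
        (c := RCLike.re ((starRingEnd 𝕜) (x n) * (x (n + 1) - x n))) (q := quadVar x n)
        (m := partialSups (fun k => ‖x k‖) n) (norm_nonneg _) (norm_nonneg _) (norm_nonneg _)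
        (quadVar_nonneg x n) (le_partialSups (fun k => ‖x k‖) n)
        (by simpa using norm_add_le (x n) (x (n + 1) - x n))
        ((RCLike.abs_re_le_norm _).trans (by simp)) e
      have eq : quadVar x (n + 1) = quadVar x n + ‖x (n + 1) - x n‖ ^ 2 := by
        rw [quadVar, Finset.sum_range_succ]; rfl
      have em : partialSups (fun k => ‖x k‖) (n + 1) =
          max (partialSups (fun k => ‖x k‖) n) ‖x (n + 1)‖ := partialSups_succ _ n
      have ew : RCLike.re ((starRingEnd 𝕜) (davisWeight x n) * (x (n + 1) - x n)) =
          RCLike.re ((starRingEnd 𝕜) (x n) * (x (n + 1) - x n)) /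
            √(quadVar x n + partialSups (fun k => ‖x k‖) n ^ 2) := by
        rw [davisWeight, map_mul (starRingEnd 𝕜), RCLike.conj_ofReal, mul_right_comm, RCLike.re_mul_ofReal,
          div_eq_mul_inv]
      rw [em, eq, Finset.sum_range_succ, map_add RCLike.re]
      simp only [prev] at ih ⊢
      rw [ew]
      linarith
  have h1 : partialSups (fun k => ‖x k‖) n ≤
      √(quadVar x n + partialSups (fun k => ‖x k‖) n ^ 2) :=
    Real.le_sqrt_of_sq_le (by linarith [quadVar_nonneg x n])
  have h2 : 0 ≤ (‖x n‖ ^ 2 + quadVar x n) /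
      √(quadVar x n + partialSups (fun k => ‖x k‖) n ^ 2) :=
    div_nonneg (by linarith [quadVar_nonneg x n, sq_nonneg ‖x n‖]) (Real.sqrt_nonneg _)
  linarith

end Pathwise

/-! ### Martingale transforms, Davis' inequality and convergence -/

section Martingales

variable {Ω 𝕜 : Type*} [RCLike 𝕜] {mΩ : MeasurableSpace Ω} {P : Measure Ω} {ℱ : Filtration ℕ mΩ}

theorem prev_apply (X : ℕ → Ω → 𝕜) (n : ℕ) (ω : Ω) : prev X n ω = prev (fun k => X k ω) n := by
  cases n <;> rfl

/-- The partial sums `∑_{k ≤ n} v_{k-1} d_k X` of a martingale transform. -/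
def transform (v X : ℕ → Ω → 𝕜) (n : ℕ) : Ω → 𝕜 := fun ω =>
  ∑ k ∈ Finset.range (n + 1), prev v k ω * diff X k ω

theorem diff_transform (v X : ℕ → Ω → 𝕜) (n : ℕ) :
    diff (transform v X) n = prev v n * diff X n := by
  ext ω
  cases n with
  | zero => simp [diff, transform, prev]
  | succ n =>
    simp only [diff_apply, prev, transform, Pi.mul_apply]
    rw [Finset.sum_range_succ, add_sub_cancel_left]

theorem stronglyMeasurable_diff {X : ℕ → Ω → 𝕜} (hX : ∀ n, StronglyMeasurable[ℱ n] (X n)) (n : ℕ) :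
    StronglyMeasurable[ℱ n] (diff X n) := by
  cases n with
  | zero => exact (hX 0).sub stronglyMeasurable_zero
  | succ n => exact (hX (n + 1)).sub ((hX n).mono (ℱ.mono n.le_succ))

theorem stronglyMeasurable_prev {X : ℕ → Ω → 𝕜} (hX : ∀ n, StronglyMeasurable[ℱ n] (X n)) (n : ℕ) :
    StronglyMeasurable[ℱ n] (prev X n) := by
  cases n with
  | zero => exact stronglyMeasurable_zero
  | succ n => exact (hX n).mono (ℱ.mono n.le_succ)

theorem integrable_diff {X : ℕ → Ω → 𝕜} (hX : ∀ n, Integrable (X n) P) (n : ℕ) :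
    Integrable (diff X n) P := by
  cases n with
  | zero => exact (hX 0).sub (integrable_zero _ _ _)
  | succ n => exact (hX (n + 1)).sub (hX n)

theorem condExp_re {m : MeasurableSpace Ω} {f : Ω → 𝕜} (hf : Integrable f P) :
    P[fun ω => RCLike.re (f ω) | m] =ᵐ[P] fun ω => RCLike.re (P[f | m] ω) :=
  ((RCLike.reCLM (K := 𝕜)).comp_condExp_comm hf).symm

theorem condExp_im {m : MeasurableSpace Ω} {f : Ω → 𝕜} (hf : Integrable f P) :
    P[fun ω => RCLike.im (f ω) | m] =ᵐ[P] fun ω => RCLike.im (P[f | m] ω) :=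
  ((RCLike.imCLM (K := 𝕜)).comp_condExp_comm hf).symm

variable [IsProbabilityMeasure P]

/-- A transform of a martingale by a predictable sequence, with integrable terms, is a
martingale. -/
theorem martingale_transform {v X : ℕ → Ω → 𝕜} (hX : Martingale X ℱ P)
    (hv : ∀ n, StronglyMeasurable[ℱ n] (v n))
    (hi : ∀ n, Integrable (fun ω => prev v n ω * diff X n ω) P) :
    Martingale (transform v X) ℱ P := by
  have hint (n : ℕ) : Integrable (transform v X n) P := integrable_finsetSum _ fun k _ => hi k
  have hmeas (n : ℕ) : StronglyMeasurable[ℱ n] (transform v X n) := by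
    refine Finset.stronglyMeasurable_fun_sum _ fun k hk => ?_
    have hk' : k ≤ n := Nat.lt_succ_iff.1 (Finset.mem_range.1 hk)
    exact ((stronglyMeasurable_prev hv k).mul (stronglyMeasurable_diff hX.1 k)).mono (ℱ.mono hk')
  refine martingale_of_condExp_sub_eq_zero_nat hmeas hint fun n => ?_
  have e : transform v X (n + 1) - transform v X n =
      fun ω => (ContinuousLinearMap.mul ℝ 𝕜) (v n ω) (diff X (n + 1) ω) := by
    have := diff_transform v X (n + 1)
    simp only [diff, prev] at this
    rw [this]
    rfl
  have h0 : P[diff X (n + 1) | ℱ n] =ᵐ[P] 0 := by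
    refine (condExp_sub (hX.integrable _) (hX.integrable _) _).trans ?_
    filter_upwards [hX.2 n (n + 1) n.le_succ, hX.2 n n le_rfl] with ω h1 h2
    simp only [Pi.sub_apply, h1, h2, sub_self, Pi.zero_apply]
  rw [e]
  refine (condExp_bilin_of_stronglyMeasurable_left _ (hv n) (hi (n + 1))
    (integrable_diff hX.integrable _)).trans ?_
  filter_upwards [h0] with ω hω
  rw [hω]; simp

/-- Martingale transforms have mean `0`, since the first term is `prev v 0 * diff X 0 = 0`. -/
theorem integral_transform {v X : ℕ → Ω → 𝕜} (h : Martingale (transform v X) ℱ P) (n : ℕ) :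
    ∫ ω, transform v X n ω ∂P = 0 := by
  have h1 := h.setIntegral_eq (Nat.zero_le n) MeasurableSet.univ
  rw [setIntegral_univ, setIntegral_univ] at h1
  rw [← h1]
  simp [transform, prev]

theorem ofReal_sqrt_quadVar_le (X : ℕ → Ω → 𝕜) (n : ℕ) (ω : Ω) :
    ENNReal.ofReal √(quadVar (fun k => X k ω) n) ≤ squareFn X ω := by
  have h : ENNReal.ofReal (quadVar (fun k => X k ω) n) ≤ ∑' k, ‖diff X k ω‖ₑ ^ 2 := by
    rw [quadVar, ENNReal.ofReal_sum_of_nonneg fun _ _ => by positivity]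
    refine le_trans (le_of_eq ?_) (ENNReal.sum_le_tsum (Finset.range (n + 1)))
    refine Finset.sum_congr rfl fun k _ => ?_
    rw [ENNReal.ofReal_pow (norm_nonneg _), ofReal_norm, diff_apply]
  rw [Real.sqrt_eq_rpow, ← ENNReal.ofReal_rpow_of_nonneg (quadVar_nonneg _ _) (by norm_num)]
  exact ENNReal.rpow_le_rpow h (by norm_num)

/-- Davis' inequality `E sup_n |X_n| ≤ 24 E S(X)`: integrate the pathwise inequality
`partialSups_norm_le`, whose last term is a martingale transform with bounded weights. -/
theorem lintegral_iSup_enorm_le {X : ℕ → Ω → 𝕜} (hX : Martingale X ℱ P) :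
    ∫⁻ ω, ⨆ n, ‖X n ω‖ₑ ∂P ≤ 24 * ∫⁻ ω, squareFn X ω ∂P := by
  have hmono (ω : Ω) : Monotone fun n => ENNReal.ofReal (partialSups (fun k => ‖X k ω‖) n) :=
    fun i j hij => ENNReal.ofReal_le_ofReal ((partialSups (fun k => ‖X k ω‖)).monotone hij)
  have hXn (k : ℕ) : StronglyMeasurable[ℱ k] (X k) := hX.1 k
  have hmax (n : ℕ) : StronglyMeasurable[ℱ n] fun ω => partialSups (fun k => ‖X k ω‖) n := by
    induction n with
    | zero => simpa using (hXn 0).norm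
    | succ n ih =>
      simp only [← Order.succ_eq_add_one, partialSups_succ]
      exact (ih.mono (ℱ.mono n.le_succ)).measurable.max (hXn (n + 1)).norm.measurable |>.stronglyMeasurable
  have hq (n : ℕ) : StronglyMeasurable[ℱ n] fun ω => quadVar (fun k => X k ω) n := by
    refine Finset.stronglyMeasurable_fun_sum _ fun k hk => ?_
    have hk' : k ≤ n := Nat.lt_succ_iff.1 (Finset.mem_range.1 hk)
    have := ((stronglyMeasurable_diff hXn k).mono (ℱ.mono hk')).norm.pow 2
    simpa only [← diff_apply] using! this
  have hw (n : ℕ) : StronglyMeasurable[ℱ n]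
      fun ω => (starRingEnd 𝕜) (davisWeight (fun k => X k ω) n) := by
    refine RCLike.continuous_conj.comp_stronglyMeasurable ?_
    refine (hXn n).mul (RCLike.continuous_ofReal.comp_stronglyMeasurable ?_)
    exact (Real.continuous_sqrt.comp_stronglyMeasurable
      ((hq n).add ((hmax n).pow 2))).inv₀
  set w : ℕ → Ω → 𝕜 := fun n ω => (starRingEnd 𝕜) (davisWeight (fun k => X k ω) n) with hwdef
  have hi (n : ℕ) : Integrable (fun ω => prev w n ω * diff X n ω) P := by
    refine (integrable_diff hX.integrable n).bdd_mul (c := 1)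
      ((stronglyMeasurable_prev hw n).mono (ℱ.le n)).aestronglyMeasurable (ae_of_all _ fun ω => ?_)
    cases n with
    | zero => simp [prev]
    | succ n => simpa [prev, w] using norm_davisWeight_le (fun k => X k ω) n
  have hT := martingale_transform hX hw hi
  have key (n : ℕ) : ∫⁻ ω, ENNReal.ofReal (partialSups (fun k => ‖X k ω‖) n) ∂P ≤
      24 * ∫⁻ ω, squareFn X ω ∂P := by
    have hle (ω : Ω) : partialSups (fun k => ‖X k ω‖) n ≤
        24 * √(quadVar (fun k => X k ω) n) + 2 * RCLike.re (transform w X n ω) := by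
      refine (partialSups_norm_le (fun k => X k ω) n).trans_eq ?_
      simp only [transform, prev_apply, diff_apply, w]
    have imax : Integrable (fun ω => partialSups (fun k => ‖X k ω‖) n) P := by
      refine (integrable_finsetSum (Finset.range (n + 1)) fun k _ => (hX.integrable k).norm).mono'
        ((hmax n).mono (ℱ.le n)).aestronglyMeasurable (ae_of_all _ fun ω => ?_)
      rw [Real.norm_of_nonneg ((norm_nonneg _).trans (le_partialSups (fun k => ‖X k ω‖) n))]
      refine partialSups_le _ _ _ fun k hk => ?_
      exact Finset.single_le_sum (f := fun k => ‖X k ω‖) (fun _ _ => norm_nonneg _)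
        (Finset.mem_range.2 (Nat.lt_succ_of_le hk))
    have iq : Integrable (fun ω => √(quadVar (fun k => X k ω) n)) P := by
      refine (integrable_finsetSum (Finset.range (n + 1))
        fun k _ => (integrable_diff hX.integrable k).norm).mono'
        (Real.continuous_sqrt.comp_stronglyMeasurable
          ((hq n).mono (ℱ.le n))).aestronglyMeasurable (ae_of_all _ fun ω => ?_)
      rw [Real.norm_of_nonneg (Real.sqrt_nonneg _)]
      refine Real.sqrt_le_iff.2 ⟨by positivity, ?_⟩
      simp only [diff_apply, quadVar]
      exact Finset.sum_sq_le_sq_sum_of_nonneg fun _ _ => norm_nonneg _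
    have it : ∫ ω, RCLike.re (transform w X n ω) ∂P = 0 := by
      rw [integral_re (hT.integrable n), integral_transform hT, map_zero]
    have h1 : ∫ ω, partialSups (fun k => ‖X k ω‖) n ∂P ≤
        24 * ∫ ω, √(quadVar (fun k => X k ω) n) ∂P := by
      refine (integral_mono imax ((iq.const_mul 24).add ((hT.integrable n).re.const_mul 2))
        hle).trans_eq ?_
      rw [integral_add' (iq.const_mul 24) ((hT.integrable n).re.const_mul 2),
        integral_const_mul, integral_const_mul, it, mul_zero, add_zero]
    rw [← ofReal_integral_eq_lintegral_ofReal imax (ae_of_all _ fun ω =>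
      (norm_nonneg _).trans (le_partialSups (fun k => ‖X k ω‖) n))]
    refine (ENNReal.ofReal_le_ofReal h1).trans ?_
    rw [ENNReal.ofReal_mul (by norm_num), ofReal_integral_eq_lintegral_ofReal iq
      (ae_of_all _ fun ω => Real.sqrt_nonneg _)]
    gcongr with ω
    · simp
    · exact ofReal_sqrt_quadVar_le X n ω
  calc ∫⁻ ω, ⨆ n, ‖X n ω‖ₑ ∂P
      ≤ ∫⁻ ω, ⨆ n, ENNReal.ofReal (partialSups (fun k => ‖X k ω‖) n) ∂P := by
        gcongr with ω n
        rw [← ofReal_norm]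
        exact ENNReal.ofReal_le_ofReal (le_partialSups (fun k => ‖X k ω‖) n)
    _ = ⨆ n, ∫⁻ ω, ENNReal.ofReal (partialSups (fun k => ‖X k ω‖) n) ∂P :=
        lintegral_iSup (fun n => ((hmax n).mono (ℱ.le n)).measurable.ennreal_ofReal)
          fun i j hij ω => hmono ω hij
    _ ≤ _ := iSup_le key

theorem tendsto_of_re_im {x : ℕ → 𝕜} {a b : ℝ} (h1 : Tendsto (fun n => RCLike.re (x n)) atTop (𝓝 a))
    (h2 : Tendsto (fun n => RCLike.im (x n)) atTop (𝓝 b)) :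
    Tendsto x atTop (𝓝 ((a : 𝕜) + b * RCLike.I)) := by
  have h := ((RCLike.continuous_ofReal (K := 𝕜)).tendsto a |>.comp h1).add
    (((RCLike.continuous_ofReal (K := 𝕜)).tendsto b |>.comp h2).mul_const RCLike.I)
  refine h.congr fun n => ?_
  simp [RCLike.re_add_im]

/-- Lévy's upward theorem for scalar functions. -/
theorem tendsto_condSeq {f : Ω → 𝕜} (hf : Integrable f P) (hm : StronglyMeasurable[⨆ n, ℱ n] f) :
    ∀ᵐ ω ∂P, Tendsto (fun n => condSeq ℱ P f n ω) atTop (𝓝 (f ω)) := by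
  have hre := hf.re.tendsto_ae_condExp (ℱ := ℱ) (RCLike.continuous_re.comp_stronglyMeasurable hm)
  have him := hf.im.tendsto_ae_condExp (ℱ := ℱ) (RCLike.continuous_im.comp_stronglyMeasurable hm)
  filter_upwards [hre, him, ae_all_iff.2 fun n => condExp_re (m := ℱ n) hf,
    ae_all_iff.2 fun n => condExp_im (m := ℱ n) hf] with ω h1 h2 h3 h4
  have := tendsto_of_re_im (𝕜 := 𝕜) (h1.congr h3) (h2.congr h4)
  rwa [RCLike.re_add_im] at this

/-- A martingale whose maximal function is integrable converges almost everywhere and is closed by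
its limit. -/
theorem exists_tendsto_and_eq_condExp {X : ℕ → Ω → 𝕜} (hX : Martingale X ℱ P)
    (h : ∫⁻ ω, ⨆ n, ‖X n ω‖ₑ ∂P < ∞) :
    ∃ u : Ω → 𝕜, Integrable u P ∧ (∀ᵐ ω ∂P, Tendsto (fun n => X n ω) atTop (𝓝 (u ω))) ∧
      ∀ n, condSeq ℱ P u n =ᵐ[P] X n := by
  have hbd (n : ℕ) : eLpNorm (X n) 1 P ≤ ((∫⁻ ω, ⨆ n, ‖X n ω‖ₑ ∂P).toNNReal : ℝ≥0∞) := by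
    rw [ENNReal.coe_toNNReal h.ne, eLpNorm_one_eq_lintegral_enorm]
    exact lintegral_mono fun ω => le_iSup (fun n => ‖X n ω‖ₑ) n
  have hre : Martingale (fun n ω => RCLike.re (X n ω)) ℱ P := by
    refine ⟨fun n => RCLike.continuous_re.comp_stronglyMeasurable (hX.1 n), fun i j hij => ?_⟩
    refine (condExp_re (hX.integrable j)).trans ?_
    filter_upwards [hX.2 i j hij] with ω hω
    rw [hω]
  have him : Martingale (fun n ω => RCLike.im (X n ω)) ℱ P := by
    refine ⟨fun n => RCLike.continuous_im.comp_stronglyMeasurable (hX.1 n), fun i j hij => ?_⟩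
    refine (condExp_im (hX.integrable j)).trans ?_
    filter_upwards [hX.2 i j hij] with ω hω
    rw [hω]
  have tre := hre.submartingale.exists_ae_tendsto_of_bdd fun n =>
    (eLpNorm_mono (fun ω => RCLike.norm_re_le_norm (X n ω))).trans (hbd n)
  have tim := him.submartingale.exists_ae_tendsto_of_bdd fun n =>
    (eLpNorm_mono (fun ω => RCLike.norm_im_le_norm (X n ω))).trans (hbd n)
  have hmeas (n : ℕ) : AEStronglyMeasurable (X n) P := (hX.integrable n).aestronglyMeasurable
  obtain ⟨u, hu, hlim⟩ := exists_stronglyMeasurable_limit_of_tendsto_ae hmeas (by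
    filter_upwards [tre, tim] with ω ⟨a, ha⟩ ⟨b, hb⟩
    exact ⟨_, tendsto_of_re_im ha hb⟩)
  have hfin : ∀ᵐ ω ∂P, ⨆ n, ‖X n ω‖ₑ < ∞ := by
    refine ae_lt_top' (AEMeasurable.iSup fun n => (hmeas n).enorm) h.ne
  have hbint : Integrable (fun ω => (⨆ n, ‖X n ω‖ₑ).toReal) P :=
    integrable_toReal_of_lintegral_ne_top (AEMeasurable.iSup fun n => (hmeas n).enorm) h.ne
  have hdom (n : ℕ) : ∀ᵐ ω ∂P, ‖X n ω‖ ≤ (⨆ n, ‖X n ω‖ₑ).toReal := by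
    filter_upwards [hfin] with ω hω
    rw [← toReal_enorm]
    exact ENNReal.toReal_mono hω.ne (le_iSup (fun n => ‖X n ω‖ₑ) n)
  have hui : Integrable u P := by
    refine hbint.mono' hu.aestronglyMeasurable ?_
    filter_upwards [hlim, ae_all_iff.2 hdom] with ω h1 h2
    exact le_of_tendsto h1.norm (Eventually.of_forall h2)
  refine ⟨u, hui, hlim, fun n => ?_⟩
  have hshift : ∀ᵐ ω ∂P, Tendsto (fun k => X (n + k) ω) atTop (𝓝 (u ω)) := by
    filter_upwards [hlim] with ω hω
    exact hω.comp (tendsto_add_atTop_nat n |>.congr fun k => add_comm k n)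
  have := tendsto_condExp_unique (m := ℱ n) (fun k => X (n + k)) (fun _ => X n) u (X n)
    (fun k => hX.integrable _) (fun _ => hX.integrable n) hshift (ae_of_all _ fun _ =>
    tendsto_const_nhds) _ hbint _ hbint (fun k => hdom _) (fun _ => hdom n)
    (fun k => (hX.2 n (n + k) (Nat.le_add_right n k)).trans (hX.2 n n le_rfl).symm)
  exact this.trans (hX.2 n n le_rfl)

end Martingales

/-! ### Consequences of the `BMO` condition -/

section Bmo

variable {Ω 𝕜 : Type*} [RCLike 𝕜] {m mΩ : MeasurableSpace Ω} {P : Measure Ω} {ℱ : Filtration ℕ mΩ}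

theorem lintegral_enorm_sq_eq {f : Ω → 𝕜} (hf : MemLp f 2 P) (A : Set Ω) :
    ∫⁻ ω in A, ‖f ω‖ₑ ^ 2 ∂P = ENNReal.ofReal (∫ ω in A, ‖f ω‖ ^ 2 ∂P) := by
  rw [ofReal_integral_eq_lintegral_ofReal (hf.integrable_norm_pow two_ne_zero).integrableOn
    (ae_of_all _ fun ω => by positivity)]
  simp only [ENNReal.ofReal_pow (norm_nonneg _), ofReal_norm]

/-- Pythagoras' theorem for the conditional expectation, localized to a set of the
`σ`-algebra. -/
theorem setLIntegral_enorm_sub_sq [IsProbabilityMeasure P] (hm : m ≤ mΩ)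
    {f v : Ω → 𝕜} (hf : MemLp f 2 P) (hv : MemLp v 2 P) (hvm : StronglyMeasurable[m] v)
    {A : Set Ω} (hA : MeasurableSet[m] A) :
    ∫⁻ ω in A, ‖f ω - v ω‖ₑ ^ 2 ∂P =
      ∫⁻ ω in A, ‖f ω - (P[f | m]) ω‖ₑ ^ 2 ∂P + ∫⁻ ω in A, ‖(P[f | m]) ω - v ω‖ₑ ^ 2 ∂P := by
  have hE : MemLp (P[f | m]) 2 P := hf.condExp one_le_two
  have ha : MemLp (f - P[f | m]) 2 P := hf.sub hE
  have hb : MemLp (P[f | m] - v) 2 P := hE.sub hv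
  have hfv : MemLp (f - v) 2 P := hf.sub hv
  have hai : Integrable (f - P[f | m]) P := ha.integrable one_le_two
  have hmul : Integrable (fun ω => (ContinuousLinearMap.mul ℝ 𝕜)
      (star (P[f | m] - v) ω) ((f - P[f | m]) ω)) P := hb.star.integrable_mul ha
  have h0 : P[f - P[f | m] | m] =ᵐ[P] 0 := by
    refine (condExp_sub (hf.integrable one_le_two) integrable_condExp _).trans ?_
    rw [condExp_of_stronglyMeasurable hm stronglyMeasurable_condExp integrable_condExp, sub_self]
  have hcross : ∫ ω in A, RCLike.re (star (P[f | m] - v) ω * (f - P[f | m]) ω) ∂P = 0 := by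
    have h1 : ∫ ω in A, star (P[f | m] - v) ω * (f - P[f | m]) ω ∂P = 0 := by
      have h2 := setIntegral_condExp hm hmul hA
      have h3 := condExp_bilin_of_stronglyMeasurable_left (m := m) (ContinuousLinearMap.mul ℝ 𝕜)
        (continuous_star.comp_stronglyMeasurable (stronglyMeasurable_condExp.sub hvm)) hmul hai
      refine h2.symm.trans ?_
      rw [integral_congr_ae (g := fun _ => (0 : 𝕜)) (ae_restrict_of_ae ?_), integral_zero]
      filter_upwards [h0, h3] with ω h4 h5
      refine h5.trans ?_
      rw [h4]
      simp
    refine (integral_re hmul.integrableOn).trans ?_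
    exact (congrArg RCLike.re h1).trans (map_zero _)
  have hsum : ∫ ω in A, ‖(f - v) ω‖ ^ 2 ∂P = ∫ ω in A, ‖(f - P[f | m]) ω‖ ^ 2 ∂P +
      ∫ ω in A, ‖(P[f | m] - v) ω‖ ^ 2 ∂P := by
    have e (ω : Ω) : ‖(f - v) ω‖ ^ 2 = ‖(f - P[f | m]) ω‖ ^ 2 + ‖(P[f | m] - v) ω‖ ^ 2 +
        2 * RCLike.re (star (P[f | m] - v) ω * (f - P[f | m]) ω) := by
      have h1 : (f - v) ω = (P[f | m] - v) ω + (f - P[f | m]) ω := by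
        simp only [Pi.sub_apply]; ring
      have h2 := norm_add_sq (𝕜 := 𝕜) ((P[f | m] - v) ω) ((f - P[f | m]) ω)
      rw [h1, h2, RCLike.inner_apply, mul_comm ((f - P[f | m]) ω)]
      simp only [Pi.star_apply, RCLike.star_def]
      ring
    have i1 := (ha.integrable_norm_pow two_ne_zero).integrableOn (s := A)
    have i2 := (hb.integrable_norm_pow two_ne_zero).integrableOn (s := A)
    have i3 := (hmul.re.const_mul 2).integrableOn (s := A)
    simp only [e]
    refine (integral_add (i1.add i2) i3).trans ?_
    refine (congrArg₂ (· + ·) (integral_add i1 i2) ((integral_const_mul _ _).trans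
      (congrArg _ hcross))).trans ?_
    simp
  have e1 := lintegral_enorm_sq_eq hfv A
  have e2 := lintegral_enorm_sq_eq ha A
  have e3 := lintegral_enorm_sq_eq hb A
  simp only [Pi.sub_apply] at e1 e2 e3 hsum
  rw [e1, e2, e3, hsum, ENNReal.ofReal_add (by positivity) (by positivity)]

theorem condSeq_stronglyMeasurable (f : Ω → 𝕜) (n : ℕ) :
    StronglyMeasurable[ℱ n] (condSeq ℱ P f n) := stronglyMeasurable_condExp

/-- If `∫_A D ≤ c μ(A)` for the sets `A` of a sub-`σ`-algebra, then `∫ w D ≤ c ∫ w` for all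
nonnegative `w` that are measurable with respect to it. -/
theorem lintegral_mul_le_of_setLIntegral_le (hm : m ≤ mΩ) {D w : Ω → ℝ≥0∞}
    {c : ℝ≥0∞} (hD : Measurable D) (hw : Measurable[m] w)
    (h : ∀ A, MeasurableSet[m] A → ∫⁻ ω in A, D ω ∂P ≤ c * P A) :
    ∫⁻ ω, w ω * D ω ∂P ≤ c * ∫⁻ ω, w ω ∂P := by
  have hle : (P.withDensity D).trim hm ≤ c • P.trim hm := by
    refine Measure.le_iff.2 fun A hA => ?_
    rw [trim_measurableSet_eq hm hA, withDensity_apply _ (hm A hA), Measure.smul_apply,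
      trim_measurableSet_eq hm hA]
    exact h A hA
  calc ∫⁻ ω, w ω * D ω ∂P = ∫⁻ ω, w ω ∂(P.withDensity D) := by
        rw [lintegral_withDensity_eq_lintegral_mul _ hD (hw.mono hm le_rfl)]
        simp only [Pi.mul_apply, mul_comm]
    _ = ∫⁻ ω, w ω ∂((P.withDensity D).trim hm) := (lintegral_trim hm hw).symm
    _ ≤ ∫⁻ ω, w ω ∂(c • P.trim hm) := lintegral_mono' hle le_rfl
    _ = c * ∫⁻ ω, w ω ∂P := by rw [lintegral_smul_measure, lintegral_trim hm hw, smul_eq_mul]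

theorem memLp_condSeq {g : Ω → 𝕜} (hg : MemLp g 2 P) (n : ℕ) : MemLp (condSeq ℱ P g n) 2 P :=
  hg.condExp one_le_two

theorem memLp_prev_condSeq {g : Ω → 𝕜} (hg : MemLp g 2 P) (n : ℕ) :
    MemLp (prev (condSeq ℱ P g) n) 2 P := by
  cases n with
  | zero => exact MemLp.zero
  | succ n => exact memLp_condSeq hg n

variable [IsProbabilityMeasure P]

/-- The conditional expectation that defines the `BMO` norm, integrated over a set of `F_n`. -/
theorem setLIntegral_sub_prev_le {g : Ω → 𝕜} (hg : MemLp g 2 P) {n : ℕ} {A : Set Ω}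
    (hA : MeasurableSet[ℱ n] A) :
    ∫⁻ ω in A, ‖g ω - prev (condSeq ℱ P g) n ω‖ₑ ^ 2 ∂P ≤ bmoNorm ℱ P g ^ 2 * P A := by
  have hu := memLp_sub_prev (ℱ := ℱ) hg n
  have hi := hu.integrable_norm_pow two_ne_zero
  rw [lintegral_enorm_sq_eq hu, ← setIntegral_condExp (ℱ.le n) hi hA]
  have hb : ∀ᵐ ω ∂P, ‖(P[fun ω => ‖g ω - prev (condSeq ℱ P g) n ω‖ ^ 2 | ℱ n]) ω‖ₑ ≤
      bmoNorm ℱ P g ^ 2 := by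
    filter_upwards [enorm_ae_le_eLpNormEssSup
      (P[fun ω => ‖g ω - prev (condSeq ℱ P g) n ω‖ ^ 2 | ℱ n]) P] with ω hω
    have := le_bmoNorm_sq (ℱ := ℱ) (P := P) g n
    rw [eLpNorm_exponent_top] at this
    exact hω.trans this
  calc _ ≤ ‖∫ ω in A, (P[fun ω => ‖g ω - prev (condSeq ℱ P g) n ω‖ ^ 2 | ℱ n]) ω ∂P‖ₑ :=
        Real.ofReal_le_enorm _
    _ ≤ ∫⁻ ω in A, ‖(P[fun ω => ‖g ω - prev (condSeq ℱ P g) n ω‖ ^ 2 | ℱ n]) ω‖ₑ ∂P :=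
        enorm_integral_le_lintegral_enorm _
    _ ≤ ∫⁻ ω in A, bmoNorm ℱ P g ^ 2 ∂P := lintegral_mono_ae (ae_restrict_of_ae hb)
    _ = _ := by rw [setLIntegral_const]

/-- The conditional square function of the tail: `E(∑_{k ≥ n} |d_k g|² | F_n) ≤ ‖g‖²_{BMO}`. -/
theorem setLIntegral_tsum_diff_le {g : Ω → 𝕜} (hg : MemLp g 2 P) {n : ℕ} {A : Set Ω}
    (hA : MeasurableSet[ℱ n] A) :
    ∫⁻ ω in A, ∑' i, ‖diff (condSeq ℱ P g) (n + i) ω‖ₑ ^ 2 ∂P ≤ bmoNorm ℱ P g ^ 2 * P A := by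
  have hd (k : ℕ) : Measurable fun ω => ‖diff (condSeq ℱ P g) k ω‖ₑ ^ 2 :=
    ((stronglyMeasurable_diff (ℱ := ℱ) (condSeq_stronglyMeasurable g) k).mono
      (ℱ.le k)).enorm.pow_const 2
  have hfin (N : ℕ) : ∀ n, MeasurableSet[ℱ n] A →
      ∑ i ∈ Finset.range N, ∫⁻ ω in A, ‖diff (condSeq ℱ P g) (n + i) ω‖ₑ ^ 2 ∂P ≤
        ∫⁻ ω in A, ‖g ω - prev (condSeq ℱ P g) n ω‖ₑ ^ 2 ∂P := by
    induction N with
    | zero => simp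
    | succ N ih =>
      intro n hA
      have h1 := ih (n + 1) (ℱ.mono n.le_succ A hA)
      have h2 := setLIntegral_enorm_sub_sq (ℱ.le n) hg (memLp_prev_condSeq hg n)
        (stronglyMeasurable_prev (ℱ := ℱ) (condSeq_stronglyMeasurable g) n) hA
      rw [Finset.sum_range_succ', h2]
      refine add_le_add (le_trans (le_of_eq ?_) h1) le_rfl
      simp only [add_assoc, add_comm 1]
  rw [lintegral_tsum fun i => (hd _).aemeasurable]
  refine (ENNReal.tsum_le_of_sum_range_le fun N => hfin N n hA).trans ?_
  exact setLIntegral_sub_prev_le hg hA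

/-- The differences of a `BMO` martingale are bounded, because the `BMO` norm subtracts `g_{k-1}`
and conditions on `F_k`. -/
theorem enorm_diff_le_bmoNorm {g : Ω → 𝕜} (hg : MemLp g 2 P) (n : ℕ) :
    ∀ᵐ ω ∂P, ‖diff (condSeq ℱ P g) n ω‖ₑ ≤ bmoNorm ℱ P g := by
  have hd : Measurable[ℱ n] fun ω => ‖diff (condSeq ℱ P g) n ω‖ₑ :=
    (stronglyMeasurable_diff (ℱ := ℱ) (condSeq_stronglyMeasurable g) n).enorm
  have hA : MeasurableSet[ℱ n] {ω | bmoNorm ℱ P g < ‖diff (condSeq ℱ P g) n ω‖ₑ} :=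
    hd measurableSet_Ioi
  set A := {ω | bmoNorm ℱ P g < ‖diff (condSeq ℱ P g) n ω‖ₑ} with hAdef
  have h1 : ∫⁻ ω in A, ‖diff (condSeq ℱ P g) n ω‖ₑ ^ 2 ∂P ≤ bmoNorm ℱ P g ^ 2 * P A := by
    refine le_trans (lintegral_mono fun ω => ?_) (setLIntegral_tsum_diff_le hg hA)
    exact ENNReal.le_tsum (f := fun i => ‖diff (condSeq ℱ P g) (n + i) ω‖ₑ ^ 2) 0
  rw [ae_iff]
  simp only [not_le]
  by_contra h0
  have hlt : bmoNorm ℱ P g ^ 2 * P A < ∫⁻ ω in A, ‖diff (condSeq ℱ P g) n ω‖ₑ ^ 2 ∂P := by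
    rw [← setLIntegral_const]
    have hB : bmoNorm ℱ P g ≠ ∞ := by
      obtain ⟨ω, hω⟩ := nonempty_of_measure_ne_zero h0
      exact hω.ne_top
    refine setLIntegral_strict_mono (ℱ.le n _ hA) h0 ((hd.mono (ℱ.le n) le_rfl).pow_const 2)
      ?_ (ae_of_all _ fun ω hω => ?_)
    · rw [setLIntegral_const]
      exact ENNReal.mul_ne_top (ENNReal.pow_ne_top hB) (measure_ne_top _ _)
    · exact ENNReal.pow_lt_pow_left two_ne_zero hω
  exact absurd h1 (not_le.2 hlt)

/-- Each term of a `BMO` martingale is bounded, with a bound that grows with the index. -/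
theorem enorm_condSeq_le_bmoNorm {g : Ω → 𝕜} (hg : MemLp g 2 P) (n : ℕ) :
    ∀ᵐ ω ∂P, ‖condSeq ℱ P g n ω‖ₑ ≤ (n + 1) * bmoNorm ℱ P g := by
  induction n with
  | zero =>
    filter_upwards [enorm_diff_le_bmoNorm (ℱ := ℱ) hg 0] with ω hω
    simpa [diff, prev] using hω
  | succ n ih =>
    filter_upwards [enorm_diff_le_bmoNorm (ℱ := ℱ) hg (n + 1), ih] with ω h1 h2
    have e : condSeq ℱ P g (n + 1) ω = condSeq ℱ P g n ω + diff (condSeq ℱ P g) (n + 1) ω := by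
      simp only [diff, prev, Pi.sub_apply]; ring
    rw [e]
    calc _ ≤ ‖condSeq ℱ P g n ω‖ₑ + ‖diff (condSeq ℱ P g) (n + 1) ω‖ₑ := enorm_add_le _ _
      _ ≤ (n + 1) * bmoNorm ℱ P g + bmoNorm ℱ P g := add_le_add h2 h1
      _ = _ := by push_cast; ring

/-- Weighted form of the `BMO` condition, for an increasing adapted sequence of weights. The proof
sums `setLIntegral_tsum_diff_le` against the increments of the weights. -/
theorem lintegral_tsum_mul_diff_le {g : Ω → 𝕜} (hg : MemLp g 2 P) {W : ℕ → Ω → ℝ≥0∞}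
    (hW : ∀ n, Measurable[ℱ n] (W n)) (hmono : ∀ ω, Monotone fun n => W n ω) :
    ∫⁻ ω, ∑' k, W k ω * ‖diff (condSeq ℱ P g) k ω‖ₑ ^ 2 ∂P ≤
      bmoNorm ℱ P g ^ 2 * ∫⁻ ω, ⨆ n, W n ω ∂P := by
  have hd (k : ℕ) : Measurable fun ω => ‖diff (condSeq ℱ P g) k ω‖ₑ ^ 2 :=
    ((stronglyMeasurable_diff (ℱ := ℱ) (condSeq_stronglyMeasurable g) k).mono
      (ℱ.le k)).enorm.pow_const 2
  -- the increments of the weights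
  let V (j : ℕ) (ω : Ω) : ℝ≥0∞ := W j ω - prev (fun i => W i ω) j
  have hV (j : ℕ) : Measurable[ℱ j] (V j) := by
    cases j with
    | zero => exact (hW 0).sub measurable_const
    | succ j => exact (hW (j + 1)).sub ((hW j).mono (ℱ.mono j.le_succ) le_rfl)
  have hsum (k : ℕ) (ω : Ω) : ∑ j ∈ Finset.range (k + 1), V j ω = W k ω := by
    induction k with
    | zero => simp [V, prev]
    | succ k ih =>
      rw [Finset.sum_range_succ, ih]
      exact add_tsub_cancel_of_le (hmono ω k.le_succ)
  have hpt (ω : Ω) : ∑' k, W k ω * ‖diff (condSeq ℱ P g) k ω‖ₑ ^ 2 =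
      ∑' j, V j ω * ∑' i, ‖diff (condSeq ℱ P g) (j + i) ω‖ₑ ^ 2 := by
    have e1 (k : ℕ) : W k ω * ‖diff (condSeq ℱ P g) k ω‖ₑ ^ 2 =
        ∑ p ∈ Finset.HasAntidiagonal.antidiagonal k, V p.1 ω * ‖diff (condSeq ℱ P g) (p.1 + p.2) ω‖ₑ ^ 2 := by
      rw [← hsum, Finset.sum_mul, Finset.Nat.sum_antidiagonal_eq_sum_range_succ
        fun i j => V i ω * ‖diff (condSeq ℱ P g) (i + j) ω‖ₑ ^ 2]
      refine Finset.sum_congr rfl fun j hj => ?_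
      rw [Nat.add_sub_cancel' (Nat.lt_succ_iff.1 (Finset.mem_range.1 hj))]
    simp only [e1, ← ENNReal.tsum_mul_left]
    rw [← ENNReal.tsum_prod,
      ← Finset.HasAntidiagonal.sigmaAntidiagonalEquivProd.tsum_eq, ENNReal.tsum_sigma']
    refine tsum_congr fun k => ?_
    exact (Finset.tsum_subtype (Finset.HasAntidiagonal.antidiagonal k)
      fun p => V p.1 ω * ‖diff (condSeq ℱ P g) (p.1 + p.2) ω‖ₑ ^ 2).symm
  simp only [hpt]
  rw [lintegral_tsum (f := fun j ω => V j ω * ∑' i, ‖diff (condSeq ℱ P g) (j + i) ω‖ₑ ^ 2)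
    fun j => (((hV j).mono (ℱ.le j) le_rfl).mul (Measurable.tsum fun i => hd _)).aemeasurable]
  calc _ ≤ ∑' j, bmoNorm ℱ P g ^ 2 * ∫⁻ ω, V j ω ∂P := by
        refine ENNReal.tsum_le_tsum fun j => ?_
        exact lintegral_mul_le_of_setLIntegral_le (ℱ.le j) (Measurable.tsum fun i => hd _)
          (hV j) fun A hA => setLIntegral_tsum_diff_le hg hA
    _ = bmoNorm ℱ P g ^ 2 * ∫⁻ ω, ∑' j, V j ω ∂P := by
        rw [ENNReal.tsum_mul_left, lintegral_tsum fun j => ((hV j).mono (ℱ.le j) le_rfl).aemeasurable]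
    _ ≤ _ := by
        gcongr with ω
        refine ENNReal.tsum_le_of_sum_range_le fun n => ?_
        cases n with
        | zero => simp
        | succ n => rw [hsum]; exact le_iSup (fun n => W n ω) n

/-! ### The John--Nirenberg inequality -/

/-- The set where a sequence exceeds the level `c` for the first time at the index `k`. -/
def firstExceed (X : ℕ → Ω → 𝕜) (c : ℝ≥0∞) (k : ℕ) : Set Ω :=
  {ω | c < ‖X k ω‖ₑ ∧ ∀ j < k, ‖X j ω‖ₑ ≤ c}

theorem measurableSet_firstExceed {X : ℕ → Ω → 𝕜} (hX : ∀ n, StronglyMeasurable[ℱ n] (X n))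
    (c : ℝ≥0∞) (k : ℕ) : MeasurableSet[ℱ k] (firstExceed X c k) := by
  have h1 : MeasurableSet[ℱ k] {ω | c < ‖X k ω‖ₑ} := (hX k).enorm measurableSet_Ioi
  have h2 : MeasurableSet[ℱ k] (⋂ j, ⋂ (_ : j < k), {ω | ‖X j ω‖ₑ ≤ c}) :=
    MeasurableSet.iInter fun j => MeasurableSet.iInter fun hj =>
      ((hX j).mono (ℱ.mono hj.le)).enorm measurableSet_Iic
  convert h1.inter h2 using 1
  ext ω
  simp [firstExceed]

theorem disjoint_firstExceed (X : ℕ → Ω → 𝕜) (c : ℝ≥0∞) :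
    Pairwise (Function.onFun Disjoint (firstExceed X c)) := by
  have h (i j : ℕ) (hij : i < j) : Disjoint (firstExceed X c i) (firstExceed X c j) :=
    Set.disjoint_left.2 fun ω hi hj => absurd (hj.2 i hij) (not_le.2 hi.1)
  intro i j hij
  rcases hij.lt_or_gt with h' | h'
  · exact h i j h'
  · exact (h j i h').symm

theorem exists_mem_firstExceed {X : ℕ → Ω → 𝕜} {c : ℝ≥0∞} {ω : Ω} (h : c < ⨆ n, ‖X n ω‖ₑ) :
    ∃ k, ω ∈ firstExceed X c k := by
  classical
  have h' : ∃ k, c < ‖X k ω‖ₑ := lt_iSup_iff.1 h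
  exact ⟨Nat.find h', Nat.find_spec h', fun j hj => not_lt.1 (Nat.find_min h' hj)⟩

/-- The John--Nirenberg step: the maximal function of a `BMO` martingale exceeds the level `c + a`
with a probability that is at most `‖g‖²_{BMO} / a²` times the probability of the level `c`. If
the level `c` is first exceeded at time `j` and `c + a` at time `k`, then `|g_k - g_{j-1}| ≥ a`. -/
theorem sq_mul_measure_lt_iSup_le {g : Ω → 𝕜} (hg : MemLp g 2 P) (c a : ℝ≥0∞) :
    a ^ 2 * P {ω | c + a < ⨆ n, ‖condSeq ℱ P g n ω‖ₑ} ≤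
      bmoNorm ℱ P g ^ 2 * P {ω | c < ⨆ n, ‖condSeq ℱ P g n ω‖ₑ} := by
  set X := condSeq ℱ P g with hX
  have hXm (n : ℕ) : StronglyMeasurable[ℱ n] (X n) := condSeq_stronglyMeasurable g n
  let T (j i : ℕ) : Set Ω := firstExceed X c j ∩ firstExceed X (c + a) (j + i)
  have hTm (j i : ℕ) : MeasurableSet[ℱ (j + i)] (T j i) :=
    (ℱ.mono (Nat.le_add_right j i) _ (measurableSet_firstExceed hXm c j)).inter
      (measurableSet_firstExceed hXm (c + a) (j + i))
  have hcover : {ω | c + a < ⨆ n, ‖X n ω‖ₑ} ⊆ ⋃ j, ⋃ i, T j i := by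
    intro ω hω
    obtain ⟨j, hj⟩ := exists_mem_firstExceed (lt_of_le_of_lt le_self_add hω)
    obtain ⟨k, hk⟩ := exists_mem_firstExceed hω
    have hjk : j ≤ k := by
      by_contra h
      exact absurd (hj.2 k (not_le.1 h)) (not_le.2 (lt_of_le_of_lt le_self_add hk.1))
    obtain ⟨i, rfl⟩ := Nat.exists_eq_add_of_le hjk
    exact Set.mem_iUnion₂.2 ⟨j, i, hj, hk⟩
  have hone (j i : ℕ) : a ^ 2 * P (T j i) ≤ ∫⁻ ω in T j i, ‖g ω - prev X j ω‖ₑ ^ 2 ∂P := by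
    have hpyth := setLIntegral_enorm_sub_sq (ℱ.le (j + i)) hg (memLp_prev_condSeq hg j)
      ((stronglyMeasurable_prev (ℱ := ℱ) hXm j).mono (ℱ.mono (Nat.le_add_right j i))) (hTm j i)
    rw [hpyth]
    refine le_trans ?_ le_add_self
    rw [← setLIntegral_const]
    refine setLIntegral_mono' (ℱ.le _ _ (hTm j i)) fun ω hω => ?_
    gcongr
    have hprev : ‖prev X j ω‖ₑ ≤ c := by
      cases j with
      | zero => simp [prev]
      | succ j => exact hω.1.2 j j.lt_succ_self
    have hc : ‖prev X j ω‖ₑ ≠ ∞ := enorm_ne_top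
    refine (ENNReal.add_le_add_iff_left hc).1 ?_
    calc ‖prev X j ω‖ₑ + a ≤ c + a := by gcongr
      _ ≤ ‖X (j + i) ω‖ₑ := hω.2.1.le
      _ = ‖prev X j ω + (X (j + i) ω - prev X j ω)‖ₑ := by rw [add_sub_cancel]
      _ ≤ _ := enorm_add_le _ _
  calc a ^ 2 * P {ω | c + a < ⨆ n, ‖X n ω‖ₑ}
      ≤ a ^ 2 * ∑' j, ∑' i, P (T j i) := by
        gcongr
        refine (measure_mono hcover).trans ((measure_iUnion_le _).trans ?_)
        exact ENNReal.tsum_le_tsum fun j => measure_iUnion_le _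
    _ = ∑' j, ∑' i, a ^ 2 * P (T j i) := by simp only [ENNReal.tsum_mul_left]
    _ ≤ ∑' j, ∑' i, ∫⁻ ω in T j i, ‖g ω - prev X j ω‖ₑ ^ 2 ∂P := by gcongr; exact hone _ _
    _ ≤ ∑' j, bmoNorm ℱ P g ^ 2 * P (firstExceed X c j) := by
        refine ENNReal.tsum_le_tsum fun j => ?_
        rw [← lintegral_iUnion (fun i => ℱ.le _ _ (hTm j i)) fun i i' hii' =>
          (disjoint_firstExceed X (c + a) (by simpa using hii')).mono Set.inter_subset_right
            Set.inter_subset_right]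
        refine le_trans (lintegral_mono_set (Set.iUnion_subset fun i => Set.inter_subset_left)) ?_
        exact setLIntegral_sub_prev_le hg (measurableSet_firstExceed hXm c j)
    _ = bmoNorm ℱ P g ^ 2 * P (⋃ j, firstExceed X c j) := by
        rw [ENNReal.tsum_mul_left, measure_iUnion (disjoint_firstExceed X c)
          fun j => ℱ.le _ _ (measurableSet_firstExceed hXm c j)]
    _ ≤ _ := by
        gcongr
        refine Set.iUnion_subset fun j ω hω => ?_
        exact lt_of_lt_of_le hω.1 (le_iSup (fun n => ‖X n ω‖ₑ) j)

end Bmo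

/-! ### Fefferman's inequality and the square function of the second product -/

section Estimates

variable {Ω 𝕜 : Type*} [RCLike 𝕜] {mΩ : MeasurableSpace Ω} {P : Measure Ω} {ℱ : Filtration ℕ mΩ}

/-- The bound for `∑ |d_k x| e_k` behind Fefferman's duality inequality: a weighted
arithmetic-geometric mean inequality, with `|d_k x|² ≤ 2 S_k (S_k - S_{k-1})` for the partial
square functions `S_k`. -/
theorem sum_norm_diff_mul_le (x : ℕ → 𝕜) (e : ℕ → ℝ) (he : ∀ n, 0 ≤ e n) {b : ℝ} (hb : 0 < b)
    (n : ℕ) :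
    ∑ k ∈ Finset.range (n + 1), ‖x k - prev x k‖ * e k ≤ b * √(quadVar x n) +
      b⁻¹ * ∑ k ∈ Finset.range (n + 1), √(quadVar x k) * e k ^ 2 := by
  -- `r = S_{k-1}`, `s = S_k` and `δ = |d_k x|`
  have key {r s δ e : ℝ} (hr : 0 ≤ r) (hs : 0 ≤ s) (hδ : 0 ≤ δ) (he : 0 ≤ e)
      (h : s ^ 2 = r ^ 2 + δ ^ 2) : δ * e ≤ b * (s - r) + b⁻¹ * (s * e ^ 2) := by
    have hrs : r ≤ s := le_of_abs_le (abs_le_of_sq_le_sq (by linarith [sq_nonneg δ]) hs)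
    set u := b * (s - r) with hu
    set v := b⁻¹ * (s * e ^ 2) with hv
    have hu0 : 0 ≤ u := mul_nonneg hb.le (sub_nonneg.2 hrs)
    have hv0 : 0 ≤ v := by positivity
    have huv : u * v = (s - r) * s * e ^ 2 := by rw [hu, hv]; field_simp
    have h1 : δ ^ 2 ≤ 2 * ((s - r) * s) := by nlinarith [sq_nonneg (s - r)]
    refine le_of_abs_le (abs_le_of_sq_le_sq ?_ (by positivity))
    calc (δ * e) ^ 2 = δ ^ 2 * e ^ 2 := mul_pow _ _ _
      _ ≤ 2 * ((s - r) * s) * e ^ 2 := by gcongr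
      _ = 2 * u * v := by rw [mul_assoc 2 u v, huv]; ring
      _ ≤ (u + v) ^ 2 := by linarith [add_sq u v, sq_nonneg u, sq_nonneg v]
  induction n with
  | zero =>
    have h := key (r := 0) (s := √(quadVar x 0)) le_rfl (Real.sqrt_nonneg _)
      (norm_nonneg (x 0 - prev x 0)) (he 0)
      (by rw [Real.sq_sqrt (quadVar_nonneg x 0)]; simp [quadVar])
    simpa using h
  | succ n ih =>
    have h := key (Real.sqrt_nonneg (quadVar x n)) (Real.sqrt_nonneg (quadVar x (n + 1)))
      (norm_nonneg (x (n + 1) - prev x (n + 1))) (he (n + 1)) (by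
        rw [Real.sq_sqrt (quadVar_nonneg x _), Real.sq_sqrt (quadVar_nonneg x _), quadVar,
          Finset.sum_range_succ]
        rfl)
    rw [Finset.sum_range_succ, Finset.sum_range_succ _ (n + 1), mul_add]
    linarith

theorem tsum_enorm_diff_mul_le (X Y : ℕ → Ω → 𝕜) {b : ℝ≥0} (hb : b ≠ 0) (ω : Ω) :
    ∑' k, ‖diff X k ω‖ₑ * ‖diff Y k ω‖ₑ ≤ b * squareFn X ω + (b : ℝ≥0∞)⁻¹ *
      ∑' k, ENNReal.ofReal √(quadVar (fun k => X k ω) k) * ‖diff Y k ω‖ₑ ^ 2 := by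
  refine ENNReal.tsum_le_of_sum_range_le fun n => ?_
  refine (Finset.sum_le_sum_of_subset (Finset.range_subset_range.2 n.le_succ)).trans ?_
  have h := ENNReal.ofReal_le_ofReal (sum_norm_diff_mul_le (fun k => X k ω)
    (fun k => ‖diff Y k ω‖) (fun _ => norm_nonneg _) (b := b)
    (NNReal.coe_pos.2 (pos_iff_ne_zero.2 hb)) n)
  have e1 : ENNReal.ofReal (∑ k ∈ Finset.range (n + 1),
      ‖X k ω - prev (fun k => X k ω) k‖ * ‖diff Y k ω‖) =
      ∑ k ∈ Finset.range (n + 1), ‖diff X k ω‖ₑ * ‖diff Y k ω‖ₑ := by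
    rw [ENNReal.ofReal_sum_of_nonneg fun _ _ => by positivity]
    refine Finset.sum_congr rfl fun k _ => ?_
    rw [ENNReal.ofReal_mul (norm_nonneg _), ofReal_norm, ofReal_norm, diff_apply X]
  rw [e1, ENNReal.ofReal_add (by positivity) (by positivity), ENNReal.ofReal_mul (by positivity),
    ENNReal.ofReal_mul (by positivity), ENNReal.ofReal_sum_of_nonneg fun _ _ => by positivity,
    ENNReal.ofReal_inv_of_pos (NNReal.coe_pos.2 (pos_iff_ne_zero.2 hb)),
    ENNReal.ofReal_coe_nnreal] at h
  refine h.trans ?_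
  gcongr
  · exact ofReal_sqrt_quadVar_le X n ω
  · refine le_trans (le_of_eq ?_) (ENNReal.sum_le_tsum (Finset.range (n + 1)))
    refine Finset.sum_congr rfl fun k _ => ?_
    rw [ENNReal.ofReal_mul (Real.sqrt_nonneg _), ENNReal.ofReal_pow (norm_nonneg _), ofReal_norm]

theorem inv_mul_sq_le {b : ℝ≥0} (hb : b ≠ 0) {B : ℝ≥0∞} (hB : B ≤ b) :
    (b : ℝ≥0∞)⁻¹ * B ^ 2 ≤ b := by
  calc (b : ℝ≥0∞)⁻¹ * B ^ 2 ≤ (b : ℝ≥0∞)⁻¹ * (b : ℝ≥0∞) ^ 2 := by gcongr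
    _ = (b : ℝ≥0∞) := by
      rw [pow_two, ← mul_assoc, ENNReal.inv_mul_cancel (by exact_mod_cast hb) ENNReal.coe_ne_top,
        one_mul]

/-- If `D` is dominated by a `BMO` condition against `w`, then `b w + b⁻¹ D` has integral at
most `2 b ∫ w`. -/
theorem lintegral_add_inv_mul_le {b : ℝ≥0} (hb : b ≠ 0) {B : ℝ≥0∞} (hB : B ≤ b) {w D : Ω → ℝ≥0∞}
    {I : ℝ≥0∞} (hw : AEMeasurable w P) (hwI : ∫⁻ ω, w ω ∂P ≤ I) (hD : ∫⁻ ω, D ω ∂P ≤ B ^ 2 * I) :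
    ∫⁻ ω, (b * w ω + (b : ℝ≥0∞)⁻¹ * D ω) ∂P ≤ 2 * b * I := by
  have hbi : (b : ℝ≥0∞)⁻¹ ≠ ∞ := ENNReal.inv_ne_top.2 (by exact_mod_cast hb)
  rw [lintegral_add_left' (hw.const_mul _), lintegral_const_mul' _ _ ENNReal.coe_ne_top,
    lintegral_const_mul' _ _ hbi]
  calc b * ∫⁻ ω, w ω ∂P + (b : ℝ≥0∞)⁻¹ * ∫⁻ ω, D ω ∂P
      ≤ b * I + (b : ℝ≥0∞)⁻¹ * (B ^ 2 * I) := by gcongr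
    _ ≤ b * I + b * I := by
        rw [← mul_assoc]
        gcongr
        exact inv_mul_sq_le hb hB
    _ = 2 * b * I := by ring

theorem aemeasurable_squareFn_condSeq (f : Ω → 𝕜) :
    AEMeasurable (squareFn (condSeq ℱ P f)) P :=
  aemeasurable_squareFn fun _ => integrable_condExp.aestronglyMeasurable

variable [IsProbabilityMeasure P]

/-- Fefferman's inequality `E ∑ |d_k f| |d_k g| ≤ C ‖f‖_{H^1} ‖g‖_{BMO}`. -/
theorem lintegral_tsum_diff_mul_diff_le (f : Ω → 𝕜) {g : Ω → 𝕜} (hg : MemLp g 2 P) {b : ℝ≥0}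
    (hb : b ≠ 0) (hgb : bmoNorm ℱ P g ≤ b) :
    ∫⁻ ω, ∑' k, ‖diff (condSeq ℱ P f) k ω‖ₑ * ‖diff (condSeq ℱ P g) k ω‖ₑ ∂P ≤
      2 * b * h1Norm ℱ P f := by
  refine (lintegral_mono fun ω => tsum_enorm_diff_mul_le _ _ hb ω).trans ?_
  refine lintegral_add_inv_mul_le hb hgb (aemeasurable_squareFn_condSeq f) le_rfl ?_
  have hq (n : ℕ) : Measurable[ℱ n] fun ω => quadVar (fun k => condSeq ℱ P f k ω) n := by
    refine (Finset.stronglyMeasurable_fun_sum _ fun k hk => ?_).measurable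
    have hk' : k ≤ n := Nat.lt_succ_iff.1 (Finset.mem_range.1 hk)
    have := ((stronglyMeasurable_diff (condSeq_stronglyMeasurable (ℱ := ℱ) (P := P) f) k).mono
      (ℱ.mono hk')).norm.pow 2
    simpa only [← diff_apply] using! this
  refine (lintegral_tsum_mul_diff_le hg (fun n => (hq n).sqrt.ennreal_ofReal) fun ω i j hij => ?_).trans ?_
  · refine ENNReal.ofReal_le_ofReal (Real.sqrt_le_sqrt ?_)
    exact Finset.sum_le_sum_of_subset_of_nonneg (Finset.range_subset_range.2 (by omega))
      fun _ _ _ => by positivity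
  · rw [h1Norm]
    gcongr with ω
    exact iSup_le fun n => ofReal_sqrt_quadVar_le _ n ω

theorem squareFn_transform (v X : ℕ → Ω → 𝕜) (ω : Ω) :
    squareFn (transform v X) ω = (∑' n, ‖prev v n ω‖ₑ ^ 2 * ‖diff X n ω‖ₑ ^ 2) ^ (1 / 2 : ℝ) := by
  simp only [squareFn, diff_transform, Pi.mul_apply, enorm_mul, mul_pow]

theorem enorm_prev_le (X : ℕ → Ω → 𝕜) (n : ℕ) (ω : Ω) :
    ‖prev X n ω‖ₑ ≤ partialSups (fun k => ‖X k ω‖ₑ) n := by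
  cases n with
  | zero => simp [prev]
  | succ n => exact le_partialSups_of_le (fun k => ‖X k ω‖ₑ) n.le_succ

/-- The bound of the square function of `∑ f_{k-1} d_k g` by the maximal function of `f`. -/
theorem lintegral_squareFn_transform_le (f : Ω → 𝕜) {g : Ω → 𝕜} (hg : MemLp g 2 P) {b : ℝ≥0}
    (hb : b ≠ 0) (hgb : bmoNorm ℱ P g ≤ b) :
    ∫⁻ ω, squareFn (transform (condSeq ℱ P f) (condSeq ℱ P g)) ω ∂P ≤
      2 * b * ∫⁻ ω, ⨆ n, ‖condSeq ℱ P f n ω‖ₑ ∂P := by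
  set X := condSeq ℱ P f with hX
  have hXm (n : ℕ) : StronglyMeasurable[ℱ n] (X n) := condSeq_stronglyMeasurable f n
  let W (n : ℕ) (ω : Ω) : ℝ≥0∞ := partialSups (fun k => ‖X k ω‖ₑ) n
  have hW (n : ℕ) : Measurable[ℱ n] (W n) := by
    induction n with
    | zero => simpa [W] using (hXm 0).enorm
    | succ n ih =>
      simp only [W, ← Order.succ_eq_add_one, partialSups_succ]
      exact (ih.mono (ℱ.mono n.le_succ) le_rfl).max (hXm (n + 1)).enorm
  have hWsup (ω : Ω) : ⨆ n, W n ω = ⨆ n, ‖X n ω‖ₑ := iSup_partialSups_eq _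
  have hb0 : (b : ℝ≥0∞) ≠ 0 := by exact_mod_cast hb
  have hpt (ω : Ω) : squareFn (transform X (condSeq ℱ P g)) ω ≤ b * (⨆ n, ‖X n ω‖ₑ) +
      (b : ℝ≥0∞)⁻¹ * ∑' k, W k ω * ‖diff (condSeq ℱ P g) k ω‖ₑ ^ 2 := by
    set M := ⨆ n, ‖X n ω‖ₑ with hM
    set D := ∑' k, W k ω * ‖diff (condSeq ℱ P g) k ω‖ₑ ^ 2 with hD
    have h1 : ∑' n, ‖prev X n ω‖ₑ ^ 2 * ‖diff (condSeq ℱ P g) n ω‖ₑ ^ 2 ≤ M * D := by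
      rw [hD, ← ENNReal.tsum_mul_left]
      refine ENNReal.tsum_le_tsum fun n => ?_
      rw [← mul_assoc, pow_two]
      gcongr
      · exact (enorm_prev_le X n ω).trans ((le_iSup (fun n => W n ω) n).trans_eq (hWsup ω))
      · exact enorm_prev_le X n ω
    have h2 : M * D ≤ (b * M + (b : ℝ≥0∞)⁻¹ * D) ^ (2 : ℝ) := by
      rw [ENNReal.rpow_two, pow_two]
      calc M * D = (b * M) * ((b : ℝ≥0∞)⁻¹ * D) := by
            rw [mul_mul_mul_comm, ENNReal.mul_inv_cancel hb0 ENNReal.coe_ne_top, one_mul]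
        _ ≤ _ := mul_le_mul' le_self_add le_add_self
    rw [squareFn_transform]
    refine (ENNReal.rpow_le_rpow (h1.trans h2) (by norm_num)).trans_eq ?_
    rw [← ENNReal.rpow_mul]
    norm_num
  refine (lintegral_mono hpt).trans (lintegral_add_inv_mul_le hb hgb ?_ le_rfl ?_)
  · exact AEMeasurable.iSup fun n => ((hXm n).mono (ℱ.le n)).enorm.aemeasurable
  · refine (lintegral_tsum_mul_diff_le hg hW fun ω => (partialSups _).monotone).trans_eq ?_
    simp only [hWsup]

/-! ### The Orlicz estimate -/

/-- The generalized Hölder inequality between `L^1` and `exp L`, in pointwise form. -/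
theorem ePhi_mul_le (s x : ℝ≥0∞) :
    ePhi (s * x) ≤ s + ∑' i : ℕ, if (i + 1 : ℝ≥0∞) < x then (3 : ℝ≥0∞) ^ (i + 2) else 0 := by
  rcases eq_or_ne s ∞ with rfl | hs
  · simp
  rcases eq_or_ne x ∞ with rfl | hx
  · have : ∑' i : ℕ, (if (i + 1 : ℝ≥0∞) < ∞ then (3 : ℝ≥0∞) ^ (i + 2) else 0) = ∞ := by
      refine top_unique (le_trans (le_of_eq ?_) (ENNReal.tsum_le_tsum (f := fun _ => (1 : ℝ≥0∞))
        fun i => ?_))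
      · exact (ENNReal.tsum_const_eq_top_of_ne_zero one_ne_zero).symm
      · rw [if_pos (by exact_mod_cast ENNReal.natCast_lt_top (i + 1))]
        exact one_le_pow₀ (by norm_num)
    rw [this]; simp
  lift s to ℝ≥0 using hs
  lift x to ℝ≥0 using hx
  rw [ePhi, if_neg (ENNReal.mul_ne_top ENNReal.coe_ne_top ENNReal.coe_ne_top), ← ENNReal.coe_mul,
    ENNReal.coe_toReal, NNReal.coe_mul, Phi]
  have hs0 : (0 : ℝ) ≤ s := s.2
  have hx0 : (0 : ℝ) ≤ x := x.2
  have hsx : (0 : ℝ) ≤ s * x := mul_nonneg hs0 hx0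
  have hlog : 1 ≤ Real.log (Real.exp 1 + s * x) := by
    rw [Real.le_log_iff_exp_le (by positivity)]; linarith
  rcases le_or_gt (x : ℝ) (Real.log (Real.exp 1 + s * x)) with h | h
  · refine le_trans ?_ le_self_add
    refine (ENNReal.ofReal_le_ofReal (q := s) ?_).trans_eq (ENNReal.ofReal_coe_nnreal)
    rw [div_le_iff₀ (by linarith)]
    gcongr
  · refine le_trans ?_ le_add_self
    have hx1 : (1 : ℝ) < x := hlog.trans_lt h
    -- the index `i` of the layer `i + 1 < x ≤ i + 2`
    obtain ⟨i, hi⟩ : ∃ i : ℕ, ⌈(x : ℝ)⌉₊ = i + 2 := by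
      have : 1 < ⌈(x : ℝ)⌉₊ := Nat.lt_ceil.2 (by simpa using hx1)
      exact ⟨⌈(x : ℝ)⌉₊ - 2, by omega⟩
    have hi1 : ((i + 1 : ℕ) : ℝ) < x := Nat.lt_ceil.1 (by omega)
    have hi2 : (x : ℝ) ≤ (i + 2 : ℕ) := hi ▸ Nat.le_ceil _
    refine le_trans ?_ (ENNReal.le_tsum i)
    have hlt : (i + 1 : ℝ≥0∞) < x := by
      have : ((i + 1 : ℕ) : ℝ≥0) < x := by exact_mod_cast hi1
      exact_mod_cast this
    rw [if_pos hlt]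
    have hexp : s * x ≤ (3 : ℝ) ^ (i + 2) := by
      have h1 : Real.exp 1 + s * x < Real.exp x := (Real.log_lt_iff_lt_exp (by positivity)).1 h
      calc (s * x : ℝ) ≤ Real.exp x := by linarith [Real.exp_pos 1]
        _ ≤ Real.exp ((i + 2 : ℕ) : ℝ) := Real.exp_le_exp.2 hi2
        _ = Real.exp 1 ^ (i + 2) := by rw [← Real.exp_nat_mul, mul_one]
        _ ≤ 3 ^ (i + 2) := by gcongr; exact Real.exp_one_lt_three.le
    refine (ENNReal.ofReal_le_ofReal ((div_le_self hsx hlog).trans hexp)).trans_eq ?_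
    rw [ENNReal.ofReal_pow (by norm_num)]
    norm_num

/-- The maximal function of a `BMO` martingale has an exponential tail. -/
theorem measure_lt_iSup_condSeq_le {g : Ω → 𝕜} (hg : MemLp g 2 P) {b : ℝ≥0}
    (hb : b ≠ 0) (hgb : bmoNorm ℱ P g ≤ b) (i : ℕ) :
    P {ω | 5 * b * (i : ℝ≥0∞) < ⨆ n, ‖condSeq ℱ P g n ω‖ₑ} ≤ (25⁻¹ : ℝ≥0∞) ^ i := by
  induction i with
  | zero => simpa using prob_le_one
  | succ i ih =>
    have h := sq_mul_measure_lt_iSup_le (ℱ := ℱ) hg (5 * b * (i : ℝ≥0∞)) (5 * b)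
    have e : 5 * b * ((i + 1 : ℕ) : ℝ≥0∞) = 5 * b * (i : ℝ≥0∞) + 5 * b := by push_cast; ring
    rw [← e] at h
    set p := P {ω | 5 * b * ((i + 1 : ℕ) : ℝ≥0∞) < ⨆ n, ‖condSeq ℱ P g n ω‖ₑ}
    have hb2 : (b : ℝ≥0∞) ^ 2 ≠ 0 := pow_ne_zero _ (by exact_mod_cast hb)
    have hb2' : (b : ℝ≥0∞) ^ 2 ≠ ∞ := ENNReal.pow_ne_top ENNReal.coe_ne_top
    have h1 : (b : ℝ≥0∞) ^ 2 * (25 * p) ≤ (b : ℝ≥0∞) ^ 2 * (25⁻¹ : ℝ≥0∞) ^ i := by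
      calc _ = (5 * b : ℝ≥0∞) ^ 2 * p := by ring
        _ ≤ _ := h.trans (by gcongr)
    have h2 : 25 * p ≤ (25⁻¹ : ℝ≥0∞) ^ i := (ENNReal.mul_le_mul_iff_right hb2 hb2').1 h1
    rw [pow_succ', ← ENNReal.div_eq_inv_mul, ENNReal.le_div_iff_mul_le (by simp) (by simp),
      mul_comm]
    exact h2

/-- The weights `3 ^ (i + 2)` of `ePhi_mul_le` against the tail of `measure_lt_iSup_condSeq_le`. -/
theorem tsum_three_pow_mul_le :
    ∑' i : ℕ, (3 : ℝ≥0∞) ^ (i + 2) * (25⁻¹ : ℝ≥0∞) ^ (i + 1) ≤ 1 / 2 := by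
  have e (i : ℕ) : (3 : ℝ≥0∞) ^ (i + 2) * (25⁻¹ : ℝ≥0∞) ^ (i + 1) =
      9 * 25⁻¹ * (3 * 25⁻¹) ^ i := by ring
  simp only [e]
  rw [ENNReal.tsum_mul_left, ENNReal.tsum_geometric]
  have h3 : (3 * 25⁻¹ : ℝ≥0∞) = ENNReal.ofReal (3 / 25) := by
    rw [ENNReal.ofReal_div_of_pos (by norm_num), div_eq_mul_inv]; norm_num
  have h9 : (9 * 25⁻¹ : ℝ≥0∞) = ENNReal.ofReal (9 / 25) := by
    rw [ENNReal.ofReal_div_of_pos (by norm_num), div_eq_mul_inv]; norm_num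
  rw [h3, h9, ← ENNReal.ofReal_one, ← ENNReal.ofReal_sub _ (by norm_num),
    ← ENNReal.ofReal_inv_of_pos (by norm_num), ← ENNReal.ofReal_mul (by norm_num),
    ← ENNReal.ofReal_ofNat, ← ENNReal.ofReal_div_of_pos (by norm_num)]
  exact ENNReal.ofReal_le_ofReal (by norm_num)

/-- The modular estimate of the square function of `∑ g_{k-1} d_k f`, which is at most
`S(f) sup_k |g_k|`. -/
theorem lintegral_ePhi_squareFn_transform_le (f : Ω → 𝕜) {g : Ω → 𝕜} (hg : MemLp g 2 P)
    {b y : ℝ≥0} (hb : b ≠ 0) (hy : y ≠ 0) (hgb : bmoNorm ℱ P g ≤ b) (hfy : h1Norm ℱ P f ≤ y) :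
    ∫⁻ ω, ePhi (squareFn (transform (condSeq ℱ P g) (condSeq ℱ P f)) ω /
      ((10 * b * y : ℝ≥0) : ℝ≥0∞)) ∂P ≤ 1 := by
  have hb0 : (b : ℝ≥0∞) ≠ 0 := by exact_mod_cast hb
  have hy0 : (y : ℝ≥0∞) ≠ 0 := by exact_mod_cast hy
  have hGm : Measurable fun ω => ⨆ n, ‖condSeq ℱ P g n ω‖ₑ := Measurable.iSup fun n =>
    ((condSeq_stronglyMeasurable (ℱ := ℱ) (P := P) g n).mono (ℱ.le n)).enorm
  have hpt (ω : Ω) : ePhi (squareFn (transform (condSeq ℱ P g) (condSeq ℱ P f)) ω /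
      ((10 * b * y : ℝ≥0) : ℝ≥0∞)) ≤ (2 * y : ℝ≥0∞)⁻¹ * squareFn (condSeq ℱ P f) ω +
      ∑' i : ℕ, Set.indicator {ω | 5 * b * ((i + 1 : ℕ) : ℝ≥0∞) < ⨆ n, ‖condSeq ℱ P g n ω‖ₑ}
        (fun _ => (3 : ℝ≥0∞) ^ (i + 2)) ω := by
    set G := ⨆ n, ‖condSeq ℱ P g n ω‖ₑ with hG
    have h1 : squareFn (transform (condSeq ℱ P g) (condSeq ℱ P f)) ω ≤
        G * squareFn (condSeq ℱ P f) ω := by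
      rw [squareFn_transform, squareFn]
      calc _ ≤ (G ^ 2 * ∑' n, ‖diff (condSeq ℱ P f) n ω‖ₑ ^ 2) ^ (1 / 2 : ℝ) := by
            rw [← ENNReal.tsum_mul_left]
            gcongr with n
            refine (enorm_prev_le _ n ω).trans ?_
            exact partialSups_le _ _ _ fun k _ => le_iSup (fun k => ‖condSeq ℱ P g k ω‖ₑ) k
        _ = _ := by
            rw [ENNReal.mul_rpow_of_nonneg _ _ (by norm_num), ← ENNReal.rpow_two,
              ← ENNReal.rpow_mul]
            norm_num
    have h2 : squareFn (transform (condSeq ℱ P g) (condSeq ℱ P f)) ω /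
        ((10 * b * y : ℝ≥0) : ℝ≥0∞) ≤
        ((2 * y : ℝ≥0∞)⁻¹ * squareFn (condSeq ℱ P f) ω) * ((5 * b : ℝ≥0∞)⁻¹ * G) := by
      have e : ((10 * b * y : ℝ≥0) : ℝ≥0∞) = (2 * y) * (5 * b) := by push_cast; ring
      rw [e, div_eq_mul_inv, ENNReal.mul_inv (Or.inl (by simp [hy]))
        (Or.inl (ENNReal.mul_ne_top (by simp) (by simp)))]
      refine (mul_le_mul_left h1 _).trans_eq (by ring)
    refine (ePhi_mono h2).trans ((ePhi_mul_le _ _).trans ?_)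
    gcongr with i
    rw [Set.indicator_apply]
    refine le_of_eq (if_congr ?_ rfl rfl)
    rw [Set.mem_ofPred_eq, ← ENNReal.div_eq_inv_mul, ENNReal.lt_div_iff_mul_lt
      (Or.inl (by simp [hb])) (Or.inl (ENNReal.mul_ne_top (by simp) (by simp))), mul_comm]
    push_cast
    rfl
  refine (lintegral_mono hpt).trans ?_
  have hset (i : ℕ) : MeasurableSet {ω | 5 * b * ((i + 1 : ℕ) : ℝ≥0∞) < ⨆ n, ‖condSeq ℱ P g n ω‖ₑ} :=
    hGm measurableSet_Ioi
  have hyi : (2 * y : ℝ≥0∞)⁻¹ ≠ ∞ := ENNReal.inv_ne_top.2 (by simp [hy])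
  rw [lintegral_add_left' ((aemeasurable_squareFn_condSeq f).const_mul _),
    lintegral_const_mul' _ _ hyi, lintegral_tsum fun i => (measurable_const.indicator
      (hset i)).aemeasurable]
  have h1 : (2 * y : ℝ≥0∞)⁻¹ * ∫⁻ ω, squareFn (condSeq ℱ P f) ω ∂P ≤ 1 / 2 := by
    calc _ ≤ (2 * y : ℝ≥0∞)⁻¹ * y := by gcongr; exact hfy
      _ = 1 / 2 := by
        rw [ENNReal.mul_inv (by simp) (by simp), mul_assoc,
          ENNReal.inv_mul_cancel hy0 ENNReal.coe_ne_top, mul_one, one_div]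
  have h2 : ∑' i : ℕ, ∫⁻ ω, Set.indicator
      {ω | 5 * b * ((i + 1 : ℕ) : ℝ≥0∞) < ⨆ n, ‖condSeq ℱ P g n ω‖ₑ}
        (fun _ => (3 : ℝ≥0∞) ^ (i + 2)) ω ∂P ≤ 1 / 2 := by
    refine le_trans (ENNReal.tsum_le_tsum fun i => ?_) tsum_three_pow_mul_le
    rw [lintegral_indicator_const (hset i)]
    gcongr
    exact measure_lt_iSup_condSeq_le hg hb hgb (i + 1)
  exact (add_le_add h1 h2).trans_eq (ENNReal.add_halves 1)

end Estimates

/-! ### Bilinear maps defined by almost everywhere limits -/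

section Bilinear

section SequenceMaps

variable (𝕜 : Type*) [RCLike 𝕜]

/-- The shift `x ↦ (x_{k-1})_k` as a linear map on sequences. -/
def prevₗ : (ℕ → 𝕜) →ₗ[𝕜] ℕ → 𝕜 where
  toFun := prev
  map_add' x y := by ext n; cases n <;> simp [prev]
  map_smul' c x := by ext n; cases n <;> simp [prev]

/-- The bilinear map `(x, y) ↦ ∑_{k < n} (a x)_k (b y)_k` on pairs of sequences. -/
noncomputable def sumMul (a b : (ℕ → 𝕜) →ₗ[𝕜] ℕ → 𝕜) (n : ℕ) :
    (ℕ → 𝕜) →ₗ[𝕜] (ℕ → 𝕜) →ₗ[𝕜] 𝕜 :=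
  ∑ k ∈ Finset.range n,
    (LinearMap.mul 𝕜 𝕜).compl₁₂ (LinearMap.proj k ∘ₗ a) (LinearMap.proj k ∘ₗ b)

variable {𝕜}

theorem sumMul_apply (a b : (ℕ → 𝕜) →ₗ[𝕜] ℕ → 𝕜) (n : ℕ) (x y : ℕ → 𝕜) :
    sumMul 𝕜 a b n x y = ∑ k ∈ Finset.range n, a x k * b y k := by
  simp [sumMul, LinearMap.sum_apply]

theorem sum_add_sum_add_sum (x y : ℕ → 𝕜) (n : ℕ) :
    ∑ k ∈ Finset.range (n + 1), (x k - prev x k) * (y k - prev y k) +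
      ∑ k ∈ Finset.range (n + 1), prev x k * (y k - prev y k) +
      ∑ k ∈ Finset.range (n + 1), prev y k * (x k - prev x k) = x n * y n := by
  induction n with
  | zero => simp [prev]
  | succ n ih =>
    rw [Finset.sum_range_succ, Finset.sum_range_succ _ (n + 1), Finset.sum_range_succ _ (n + 1)]
    simp only [prev] at ih ⊢
    linear_combination ih

end SequenceMaps

variable {Ω 𝕜 : Type*} [RCLike 𝕜] {mΩ : MeasurableSpace Ω} {P : Measure Ω} {ℱ : Filtration ℕ mΩ}

theorem condSeq_lp_add {p : ℝ≥0∞} (hp : 1 ≤ p) [IsFiniteMeasure P] (f g : Lp 𝕜 p P) :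
    ∀ᵐ ω ∂P, (fun n => condSeq ℱ P (f + g : Lp 𝕜 p P) n ω) =
      (fun n => condSeq ℱ P f n ω) + fun n => condSeq ℱ P g n ω := by
  have h (n : ℕ) : condSeq ℱ P (f + g : Lp 𝕜 p P) n =ᵐ[P] condSeq ℱ P f n + condSeq ℱ P g n :=
    (condExp_congr_ae (Lp.coeFn_add f g)).trans
      (condExp_add ((Lp.memLp f).integrable hp) ((Lp.memLp g).integrable hp) _)
  filter_upwards [ae_all_iff.2 h] with ω hω
  exact funext hω

theorem condSeq_lp_smul {p : ℝ≥0∞} (c : 𝕜) (f : Lp 𝕜 p P) :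
    ∀ᵐ ω ∂P, (fun n => condSeq ℱ P (c • f : Lp 𝕜 p P) n ω) =
      c • fun n => condSeq ℱ P f n ω := by
  have h (n : ℕ) : condSeq ℱ P (c • f : Lp 𝕜 p P) n =ᵐ[P] c • condSeq ℱ P f n :=
    (condExp_congr_ae (Lp.coeFn_smul c f)).trans (condExp_smul c _ _)
  filter_upwards [ae_all_iff.2 h] with ω hω
  exact funext hω

theorem integrable_prev_mul_diff {v X : ℕ → Ω → 𝕜} (hX : ∀ n, Integrable (X n) P)
    (hv : ∀ n, AEStronglyMeasurable (prev v n) P) {c : ℕ → ℝ≥0∞} (hc : ∀ n, c n ≠ ∞)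
    (hvc : ∀ n, ∀ᵐ ω ∂P, ‖v n ω‖ₑ ≤ c n) (n : ℕ) :
    Integrable (fun ω => prev v n ω * diff X n ω) P := by
  refine (integrable_diff hX n).bdd_mul (c := (prev c n).toReal) (hv n) ?_
  cases n with
  | zero => simp [prev]
  | succ n =>
    filter_upwards [hvc n] with ω hω
    rw [← toReal_enorm]
    exact ENNReal.toReal_mono (hc n) hω

variable [IsProbabilityMeasure P]

/-- Almost everywhere limits of bilinear expressions in the sequences `E(f | F_k)` and
`E(g | F_k)`, when they exist and are integrable, define a bilinear map; `Q` records further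
properties of the limits. -/
theorem exists_bilinear_of_tendsto (B : ℕ → (ℕ → 𝕜) →ₗ[𝕜] (ℕ → 𝕜) →ₗ[𝕜] 𝕜)
    (Q : H1 𝕜 ℱ P → BMO 𝕜 ℱ P → Lp 𝕜 1 P → Prop)
    (h : ∀ f g, ∃ u, Q f g u ∧ ∀ᵐ ω ∂P, Tendsto (fun n => B n
      (fun k => condSeq ℱ P (f : Lp 𝕜 1 P) k ω) (fun k => condSeq ℱ P (g : Lp 𝕜 2 P) k ω))
      atTop (𝓝 (u ω))) :
    ∃ L : H1 𝕜 ℱ P →ₗ[𝕜] BMO 𝕜 ℱ P →ₗ[𝕜] Lp 𝕜 1 P, ∀ f g, Q f g (L f g) ∧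
      ∀ᵐ ω ∂P, Tendsto (fun n => B n (fun k => condSeq ℱ P (f : Lp 𝕜 1 P) k ω)
        (fun k => condSeq ℱ P (g : Lp 𝕜 2 P) k ω)) atTop (𝓝 (L f g ω)) := by
  choose u hQ hu using h
  refine ⟨LinearMap.mk₂ 𝕜 u ?_ ?_ ?_ ?_, fun f g => ⟨hQ f g, hu f g⟩⟩
  · intro f f' g
    refine Lp.ext ?_
    filter_upwards [hu (f + f') g, hu f g, hu f' g, Lp.coeFn_add (u f g) (u f' g),
      condSeq_lp_add (ℱ := ℱ) le_rfl (f : Lp 𝕜 1 P) (f' : Lp 𝕜 1 P)] with ω h1 h2 h3 h4 h5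
    rw [h4]
    refine tendsto_nhds_unique h1 ((h2.add h3).congr fun n => ?_)
    rw [Submodule.coe_add, h5, map_add, LinearMap.add_apply]
  · intro c f g
    refine Lp.ext ?_
    filter_upwards [hu (c • f) g, hu f g, Lp.coeFn_smul c (u f g),
      condSeq_lp_smul (ℱ := ℱ) c (f : Lp 𝕜 1 P)] with ω h1 h2 h3 h4
    rw [h3]
    refine tendsto_nhds_unique h1 ((h2.const_smul c).congr fun n => ?_)
    rw [Submodule.coe_smul, h4, map_smul, LinearMap.smul_apply]
  · intro f g g'
    refine Lp.ext ?_
    filter_upwards [hu f (g + g'), hu f g, hu f g', Lp.coeFn_add (u f g) (u f g'),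
      condSeq_lp_add (ℱ := ℱ) one_le_two (g : Lp 𝕜 2 P) (g' : Lp 𝕜 2 P)] with ω h1 h2 h3 h4 h5
    rw [h4]
    refine tendsto_nhds_unique h1 ((h2.add h3).congr fun n => ?_)
    rw [Submodule.coe_add, h5, map_add]
  · intro c f g
    refine Lp.ext ?_
    filter_upwards [hu f (c • g), hu f g, Lp.coeFn_smul c (u f g),
      condSeq_lp_smul (ℱ := ℱ) c (g : Lp 𝕜 2 P)] with ω h1 h2 h3 h4
    rw [h3]
    refine tendsto_nhds_unique h1 ((h2.const_smul c).congr fun n => ?_)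
    rw [Submodule.coe_smul, h4, map_smul]

/-! ### The three products -/

/-- A bound by `b y` for all `b > B` and `y > Y` is a bound by `B Y`. This removes the
positivity conditions of the estimates, so that `B = 0` and `Y = 0` need no special treatment. -/
theorem le_mul_of_forall_nnreal {x B Y : ℝ≥0∞} (hB : B ≠ ∞) (hY : Y ≠ ∞)
    (h : ∀ b y : ℝ≥0, B < b → Y < y → x ≤ b * y) : x ≤ B * Y := by
  refine ENNReal.le_mul_of_forall_lt (Or.inr hY) (Or.inl hB) fun b' hb' y' hy' => ?_
  obtain ⟨b, hb, hb1⟩ := ENNReal.lt_iff_exists_nnreal_btwn.1 hb'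
  obtain ⟨y, hy, hy1⟩ := ENNReal.lt_iff_exists_nnreal_btwn.1 hy'
  exact (h b y hb hy).trans (by gcongr)

theorem ne_zero_of_lt_coe {B : ℝ≥0∞} {b : ℝ≥0} (h : B < b) : b ≠ 0 := by
  rintro rfl
  simp at h

section Products

variable {f g : Ω → 𝕜}

/-- The partial sums of `∑ g_{k-1} d_k f` form a martingale: the terms of a `BMO` martingale are
bounded. -/
theorem martingale_transform_bmo (f : Ω → 𝕜) (hg : MemLp g 2 P) (hgB : bmoNorm ℱ P g < ∞) :
    Martingale (transform (condSeq ℱ P g) (condSeq ℱ P f)) ℱ P := by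
  refine martingale_transform (martingale_condExp f ℱ P) (condSeq_stronglyMeasurable g)
    (integrable_prev_mul_diff (fun n => integrable_condExp)
      (fun n => (memLp_prev_condSeq hg n).aestronglyMeasurable)
      (c := fun n => (n + 1) * bmoNorm ℱ P g) (fun n => ?_) (enorm_condSeq_le_bmoNorm hg))
  exact ENNReal.mul_ne_top (by exact_mod_cast ENNReal.natCast_ne_top (n + 1)) hgB.ne

/-- The partial sums of `∑ f_{k-1} d_k g` form a martingale: the differences of a `BMO` martingale
are bounded. -/
theorem martingale_transform_h1 (f : Ω → 𝕜) (hg : MemLp g 2 P) (hgB : bmoNorm ℱ P g < ∞) :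
    Martingale (transform (condSeq ℱ P f) (condSeq ℱ P g)) ℱ P := by
  refine martingale_transform (martingale_condExp g ℱ P) (condSeq_stronglyMeasurable f)
    fun n => ?_
  have hi : Integrable (prev (condSeq ℱ P f) n) P := by
    cases n with
    | zero => exact integrable_zero _ _ _
    | succ n => exact integrable_condExp
  refine hi.mul_bdd (c := (bmoNorm ℱ P g).toReal)
    ((stronglyMeasurable_diff (ℱ := ℱ) (condSeq_stronglyMeasurable g) n).mono
      (ℱ.le n)).aestronglyMeasurable ?_
  filter_upwards [enorm_diff_le_bmoNorm (ℱ := ℱ) hg n] with ω hω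
  rw [← toReal_enorm]
  exact ENNReal.toReal_mono hgB.ne hω

theorem exists_tendsto_sum_diff_mul_diff (hf : h1Norm ℱ P f < ∞)
    (hg : MemLp g 2 P) (hgB : bmoNorm ℱ P g < ∞) :
    ∃ u : Lp 𝕜 1 P, eLpNorm u 1 P ≤ 48 * h1Norm ℱ P f * bmoNorm ℱ P g ∧
      ∀ᵐ ω ∂P, Tendsto (fun n => ∑ k ∈ Finset.range n,
        diff (condSeq ℱ P f) k ω * diff (condSeq ℱ P g) k ω) atTop (𝓝 (u ω)) := by
  have hle : ∫⁻ ω, ∑' k, ‖diff (condSeq ℱ P f) k ω‖ₑ * ‖diff (condSeq ℱ P g) k ω‖ₑ ∂P ≤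
      (2 * bmoNorm ℱ P g) * h1Norm ℱ P f := by
    rw [mul_right_comm, mul_comm]
    refine le_mul_of_forall_nnreal hgB.ne (ENNReal.mul_ne_top (by simp) hf.ne)
      fun b y hb hy => ?_
    refine (lintegral_tsum_diff_mul_diff_le f hg (ne_zero_of_lt_coe hb) hb.le).trans ?_
    rw [mul_comm 2 (b : ℝ≥0∞), mul_assoc]
    gcongr
  have hm (X : Ω → 𝕜) (k : ℕ) : StronglyMeasurable (diff (condSeq ℱ P X) k) :=
    (stronglyMeasurable_diff (ℱ := ℱ) (condSeq_stronglyMeasurable X) k).mono (ℱ.le k)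
  have hfin : ∀ᵐ ω ∂P,
      ∑' k, ‖diff (condSeq ℱ P f) k ω‖ₑ * ‖diff (condSeq ℱ P g) k ω‖ₑ < ∞ := by
    refine ae_lt_top (Measurable.tsum fun k => (hm f k).enorm.mul (hm g k).enorm) ?_
    exact (hle.trans_lt (ENNReal.mul_lt_top (ENNReal.mul_lt_top (by simp) hgB) hf)).ne
  let u : Ω → 𝕜 := fun ω => ∑' k, diff (condSeq ℱ P f) k ω * diff (condSeq ℱ P g) k ω
  have hlim : ∀ᵐ ω ∂P, Tendsto (fun n => ∑ k ∈ Finset.range n,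
      diff (condSeq ℱ P f) k ω * diff (condSeq ℱ P g) k ω) atTop (𝓝 (u ω)) := by
    filter_upwards [hfin] with ω hω
    refine (Summable.hasSum ?_).tendsto_sum_nat
    refine Summable.of_enorm ?_
    simpa only [enorm_mul] using hω.ne
  have hum : AEStronglyMeasurable u P := aestronglyMeasurable_of_tendsto_ae atTop
    (fun n => (Finset.stronglyMeasurable_fun_sum (Finset.range n)
      fun k _ => (hm f k).mul (hm g k)).aestronglyMeasurable) hlim
  have hunorm : eLpNorm u 1 P ≤ (2 * bmoNorm ℱ P g) * h1Norm ℱ P f := by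
    rw [eLpNorm_one_eq_lintegral_enorm]
    refine (lintegral_mono fun ω => ?_).trans hle
    simp only [← enorm_mul]
    exact enorm_tsum_le_tsum_enorm
  have hu : MemLp u 1 P :=
    ⟨hum, hunorm.trans_lt (ENNReal.mul_lt_top (ENNReal.mul_lt_top (by simp) hgB) hf)⟩
  refine ⟨hu.toLp u, ?_, ?_⟩
  · rw [eLpNorm_congr_ae hu.coeFn_toLp]
    refine hunorm.trans ?_
    rw [mul_right_comm]
    gcongr
    norm_num
  · filter_upwards [hlim, hu.coeFn_toLp] with ω h1 h2
    rwa [h2]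

theorem exists_tendsto_sum_prev_mul_diff (hf : h1Norm ℱ P f < ∞)
    (hg : MemLp g 2 P) (hgB : bmoNorm ℱ P g < ∞) :
    ∃ u : Lp 𝕜 1 P, h1Norm ℱ P u ≤ 48 * h1Norm ℱ P f * bmoNorm ℱ P g ∧
      ∀ᵐ ω ∂P, Tendsto (fun n => ∑ k ∈ Finset.range n,
        prev (condSeq ℱ P f) k ω * diff (condSeq ℱ P g) k ω) atTop (𝓝 (u ω)) := by
  have hM := martingale_transform_h1 (ℱ := ℱ) f hg hgB
  have hle : ∫⁻ ω, squareFn (transform (condSeq ℱ P f) (condSeq ℱ P g)) ω ∂P ≤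
      48 * h1Norm ℱ P f * bmoNorm ℱ P g := by
    rw [mul_comm _ (bmoNorm ℱ P g)]
    refine le_mul_of_forall_nnreal hgB.ne (ENNReal.mul_ne_top (by simp) hf.ne)
      fun b y hb hy => ?_
    refine (lintegral_squareFn_transform_le f hg (ne_zero_of_lt_coe hb) hb.le).trans ?_
    calc _ ≤ 2 * b * (24 * h1Norm ℱ P f) := by
          gcongr
          exact lintegral_iSup_enorm_le (martingale_condExp f ℱ P)
      _ = b * (48 * h1Norm ℱ P f) := by ring
      _ ≤ b * y := by gcongr
  have hfin : 48 * h1Norm ℱ P f * bmoNorm ℱ P g < ∞ :=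
    ENNReal.mul_lt_top (ENNReal.mul_lt_top (by simp) hf) hgB
  obtain ⟨u, hu, hlim, hcond⟩ := exists_tendsto_and_eq_condExp hM
    ((lintegral_iSup_enorm_le hM).trans_lt (ENNReal.mul_lt_top (by simp) (hle.trans_lt hfin)))
  have hu1 : MemLp u 1 P := memLp_one_iff_integrable.2 hu
  refine ⟨hu1.toLp u, ?_, ?_⟩
  · refine le_trans (le_of_eq (lintegral_congr_ae ?_)) hle
    have h1 (n : ℕ) : condSeq ℱ P (hu1.toLp u) n =ᵐ[P] condSeq ℱ P u n :=
      condExp_congr_ae hu1.coeFn_toLp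
    filter_upwards [ae_all_iff.2 h1, ae_all_iff.2 hcond] with ω h2 h3
    exact squareFn_congr fun n => (h2 n).trans (h3 n)
  · filter_upwards [hlim, hu1.coeFn_toLp] with ω h1 h2
    rw [h2]
    exact (tendsto_add_atTop_iff_nat 1).1 h1

theorem lPhiNorm_transform_le (hf : h1Norm ℱ P f < ∞) (hg : MemLp g 2 P)
    (hgB : bmoNorm ℱ P g < ∞) :
    lPhiNorm P (squareFn (transform (condSeq ℱ P g) (condSeq ℱ P f))) ≤
      48 * h1Norm ℱ P f * bmoNorm ℱ P g := by
  have h : lPhiNorm P (squareFn (transform (condSeq ℱ P g) (condSeq ℱ P f))) ≤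
      (10 * h1Norm ℱ P f) * bmoNorm ℱ P g := by
    rw [mul_comm _ (bmoNorm ℱ P g)]
    refine le_mul_of_forall_nnreal hgB.ne (ENNReal.mul_ne_top (by simp) hf.ne)
      fun b y hb hy => ?_
    have hb0 := ne_zero_of_lt_coe hb
    have hy0 := ne_zero_of_lt_coe hy
    have hfy : h1Norm ℱ P f ≤ ((y / 10 : ℝ≥0) : ℝ≥0∞) := by
      rw [ENNReal.coe_div (by norm_num), ENNReal.le_div_iff_mul_le (by simp) (by simp), mul_comm]
      exact_mod_cast hy.le
    have hint := lintegral_ePhi_squareFn_transform_le f hg hb0 (div_ne_zero hy0 (by norm_num))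
      hb.le hfy
    have e : 10 * b * (y / 10) = b * y := by field_simp
    rw [e] at hint
    refine (iInf₂_le (b * y) ⟨by positivity, hint⟩).trans_eq ?_
    push_cast
    rfl
  refine h.trans ?_
  gcongr
  norm_num

theorem memLPhi_transform (hf : h1Norm ℱ P f < ∞) (hg : MemLp g 2 P)
    (hgB : bmoNorm ℱ P g < ∞) :
    MemLPhi P (squareFn (transform (condSeq ℱ P g) (condSeq ℱ P f))) := by
  refine ⟨aemeasurable_squareFn fun n =>
    ((martingale_transform_bmo (ℱ := ℱ) f hg hgB).integrable n).aestronglyMeasurable, ?_⟩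
  obtain ⟨b, hb, -⟩ := ENNReal.lt_iff_exists_nnreal_btwn.1 hgB
  obtain ⟨y, hy, -⟩ := ENNReal.lt_iff_exists_nnreal_btwn.1 hf
  have hb0 := ne_zero_of_lt_coe hb
  have hy0 := ne_zero_of_lt_coe hy
  exact ⟨10 * b * y, by positivity,
    (lintegral_ePhi_squareFn_transform_le f hg hb0 hy0 hb.le hy.le).trans_lt ENNReal.one_lt_top⟩

end Products

end Bilinear

end MartingaleHardy

open MartingaleHardy in
theorem theoremA :
    ∃ C : ℝ≥0, ∀ (𝕜 : Type*) [RCLike 𝕜] (Ω : Type*) [mΩ : MeasurableSpace Ω]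
      (P : Measure Ω) [IsProbabilityMeasure P] (ℱ : Filtration ℕ mΩ), (⨆ n, ℱ n) = mΩ →
      ∃ (pi₁ : H1 𝕜 ℱ P →ₗ[𝕜] BMO 𝕜 ℱ P →ₗ[𝕜] Lp 𝕜 1 P)
        (pi₂ : H1 𝕜 ℱ P →ₗ[𝕜] BMO 𝕜 ℱ P →ₗ[𝕜] H1 𝕜 ℱ P)
        (pi₃ : H1 𝕜 ℱ P →ₗ[𝕜] BMO 𝕜 ℱ P →ₗ[𝕜] HPhi 𝕜 ℱ P),
        -- continuity, that is, boundedness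
        (∀ f g, eLpNorm (pi₁ f g) 1 P ≤ C * h1Norm ℱ P (f : Lp 𝕜 1 P) * bmoNorm ℱ P (g : Lp 𝕜 2 P)) ∧
        (∀ f g, h1Norm ℱ P (pi₂ f g : Lp 𝕜 1 P) ≤
          C * h1Norm ℱ P (f : Lp 𝕜 1 P) * bmoNorm ℱ P (g : Lp 𝕜 2 P)) ∧
        (∀ f g, hPhiNorm P (fun n => ((pi₃ f g : ℕ → Lp 𝕜 1 P) n : Ω → 𝕜)) ≤
          C * h1Norm ℱ P (f : Lp 𝕜 1 P) * bmoNorm ℱ P (g : Lp 𝕜 2 P)) ∧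
        ∀ (f : H1 𝕜 ℱ P) (g : BMO 𝕜 ℱ P),
          -- the martingale `pi₃ f g` has the terms `∑_{j ≤ n} g_{j-1} d_j f`
          (∀ n, ∀ᵐ ω ∂P, (pi₃ f g : ℕ → Lp 𝕜 1 P) n ω =
            ∑ j ∈ Finset.range (n + 1),
              prev (condSeq ℱ P (g : Lp 𝕜 2 P)) j ω * diff (condSeq ℱ P (f : Lp 𝕜 1 P)) j ω) ∧
          -- the three series converge almost everywhere, to `pi₁ f g`, to `pi₂ f g`, and to the
          -- limit `p₃` of the martingale `pi₃ f g`, and the three sums add up to `f g`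
          ∃ p₃ : Ω → 𝕜, ∀ᵐ ω ∂P,
            Tendsto (fun n => ∑ j ∈ Finset.range n,
              diff (condSeq ℱ P (f : Lp 𝕜 1 P)) j ω * diff (condSeq ℱ P (g : Lp 𝕜 2 P)) j ω)
              atTop (𝓝 (pi₁ f g ω)) ∧
            Tendsto (fun n => ∑ j ∈ Finset.range n,
              prev (condSeq ℱ P (f : Lp 𝕜 1 P)) j ω * diff (condSeq ℱ P (g : Lp 𝕜 2 P)) j ω)
              atTop (𝓝 ((pi₂ f g : Lp 𝕜 1 P) ω)) ∧
            Tendsto (fun n => ∑ j ∈ Finset.range n,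
              prev (condSeq ℱ P (g : Lp 𝕜 2 P)) j ω * diff (condSeq ℱ P (f : Lp 𝕜 1 P)) j ω)
              atTop (𝓝 (p₃ ω)) ∧
            (f : Lp 𝕜 1 P) ω * (g : Lp 𝕜 2 P) ω = pi₁ f g ω + (pi₂ f g : Lp 𝕜 1 P) ω + p₃ ω := by
  refine ⟨48, ?_⟩
  intro 𝕜 _ Ω mΩ P _ ℱ hℱ
  have hf (f : H1 𝕜 ℱ P) : h1Norm ℱ P (f : Lp 𝕜 1 P) < ∞ := f.2
  have hfi (f : H1 𝕜 ℱ P) : Integrable (f : Lp 𝕜 1 P) P :=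
    memLp_one_iff_integrable.1 (Lp.memLp _)
  have hg (g : BMO 𝕜 ℱ P) : MemLp (g : Lp 𝕜 2 P) 2 P := Lp.memLp _
  have hgB (g : BMO 𝕜 ℱ P) : bmoNorm ℱ P (g : Lp 𝕜 2 P) < ∞ := g.2
  let p : (ℕ → 𝕜) →ₗ[𝕜] ℕ → 𝕜 := prevₗ 𝕜
  let d : (ℕ → 𝕜) →ₗ[𝕜] ℕ → 𝕜 := LinearMap.id - prevₗ 𝕜
  have hd (X : ℕ → Ω → 𝕜) (k : ℕ) (ω : Ω) : d (fun k => X k ω) k = diff X k ω :=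
    (diff_apply X k ω).symm
  have hp (X : ℕ → Ω → 𝕜) (k : ℕ) (ω : Ω) : p (fun k => X k ω) k = prev X k ω :=
    (prev_apply X k ω).symm
  obtain ⟨L₁, hL₁⟩ := exists_bilinear_of_tendsto (ℱ := ℱ) (P := P) (sumMul 𝕜 d d)
    (fun f g u => eLpNorm u 1 P ≤
      48 * h1Norm ℱ P (f : Lp 𝕜 1 P) * bmoNorm ℱ P (g : Lp 𝕜 2 P)) fun f g => by
      simpa only [sumMul_apply, hd] using exists_tendsto_sum_diff_mul_diff (hf f) (hg g) (hgB g)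
  obtain ⟨L₂, hL₂⟩ := exists_bilinear_of_tendsto (ℱ := ℱ) (P := P) (sumMul 𝕜 p d)
    (fun f g u => h1Norm ℱ P u ≤
      48 * h1Norm ℱ P (f : Lp 𝕜 1 P) * bmoNorm ℱ P (g : Lp 𝕜 2 P)) fun f g => by
      simpa only [sumMul_apply, hd, hp] using
        exists_tendsto_sum_prev_mul_diff (hf f) (hg g) (hgB g)
  -- the terms of the third martingale, as limits of constant sequences
  have hmart (f : H1 𝕜 ℱ P) (g : BMO 𝕜 ℱ P) := martingale_transform_bmo (ℱ := ℱ)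
    (f : Lp 𝕜 1 P) (hg g) (hgB g)
  have hthree (n : ℕ) := exists_bilinear_of_tendsto (ℱ := ℱ) (P := P)
    (fun _ => sumMul 𝕜 d p (n + 1))
    (fun f g u => u =ᵐ[P] transform (condSeq ℱ P (g : Lp 𝕜 2 P)) (condSeq ℱ P (f : Lp 𝕜 1 P)) n)
    fun f g => by
      have hM : MemLp (transform (condSeq ℱ P (g : Lp 𝕜 2 P)) (condSeq ℱ P (f : Lp 𝕜 1 P)) n) 1 P :=
        memLp_one_iff_integrable.2 ((hmart f g).integrable n)
      refine ⟨hM.toLp _, hM.coeFn_toLp, ?_⟩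
      filter_upwards [hM.coeFn_toLp] with ω hω
      rw [hω]
      refine tendsto_const_nhds.congr fun _ => ?_
      simp only [transform, sumMul_apply, hd, hp, mul_comm]
  choose L₃ hL₃ using hthree
  have hae (f : H1 𝕜 ℱ P) (g : BMO 𝕜 ℱ P) : ∀ᵐ ω ∂P, ∀ n, (L₃ n f g : Ω → 𝕜) ω =
      transform (condSeq ℱ P (g : Lp 𝕜 2 P)) (condSeq ℱ P (f : Lp 𝕜 1 P)) n ω :=
    ae_all_iff.2 fun n => (hL₃ n f g).1
  have hsq (f : H1 𝕜 ℱ P) (g : BMO 𝕜 ℱ P) : ∀ᵐ ω ∂P, squareFn (fun n => (L₃ n f g : Ω → 𝕜)) ω =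
      squareFn (transform (condSeq ℱ P (g : Lp 𝕜 2 P)) (condSeq ℱ P (f : Lp 𝕜 1 P))) ω := by
    filter_upwards [hae f g] with ω hω
    exact squareFn_congr hω
  have hmem₂ (f : H1 𝕜 ℱ P) (g : BMO 𝕜 ℱ P) : L₂ f g ∈ H1 𝕜 ℱ P :=
    (hL₂ f g).1.trans_lt (ENNReal.mul_lt_top (ENNReal.mul_lt_top (by simp) (hf f)) (hgB g))
  have hmem₃ (f : H1 𝕜 ℱ P) (g : BMO 𝕜 ℱ P) : (fun n => L₃ n f g) ∈ HPhi 𝕜 ℱ P := by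
    refine ⟨fun i j hij => ?_, (memLPhi_transform (hf f) (hg g) (hgB g)).mono
      (aemeasurable_squareFn fun n => Lp.aestronglyMeasurable _) ?_⟩
    · exact (condExp_congr_ae (hL₃ j f g).1).trans
        (((hmart f g).2 i j hij).trans (hL₃ i f g).1.symm)
    · filter_upwards [hsq f g] with ω hω
      exact hω.le
  let pi₂ : H1 𝕜 ℱ P →ₗ[𝕜] BMO 𝕜 ℱ P →ₗ[𝕜] H1 𝕜 ℱ P :=
    LinearMap.mk₂ 𝕜 (fun f g => ⟨L₂ f g, hmem₂ f g⟩)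
      (fun _ _ _ => Subtype.ext (by simp)) (fun _ _ _ => Subtype.ext (by simp))
      (fun _ _ _ => Subtype.ext (by simp)) (fun _ _ _ => Subtype.ext (by simp))
  let pi₃ : H1 𝕜 ℱ P →ₗ[𝕜] BMO 𝕜 ℱ P →ₗ[𝕜] HPhi 𝕜 ℱ P :=
    LinearMap.mk₂ 𝕜 (fun f g => ⟨fun n => L₃ n f g, hmem₃ f g⟩)
      (fun _ _ _ => Subtype.ext (by ext1 n; simp)) (fun _ _ _ => Subtype.ext (by ext1 n; simp))
      (fun _ _ _ => Subtype.ext (by ext1 n; simp)) (fun _ _ _ => Subtype.ext (by ext1 n; simp))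
  refine ⟨L₁, pi₂, pi₃, fun f g => (hL₁ f g).1, fun f g => (hL₂ f g).1, fun f g => ?_,
    fun f g => ⟨fun n => (hL₃ n f g).1, ?_⟩⟩
  · refine le_trans (le_of_eq ?_) (lPhiNorm_transform_le (hf f) (hg g) (hgB g))
    unfold hPhiNorm lPhiNorm
    have e (l : ℝ≥0) : ∫⁻ ω, ePhi (squareFn (fun n => (L₃ n f g : Ω → 𝕜)) ω / l) ∂P =
        ∫⁻ ω, ePhi (squareFn (transform (condSeq ℱ P (g : Lp 𝕜 2 P))
          (condSeq ℱ P (f : Lp 𝕜 1 P))) ω / l) ∂P := by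
      refine lintegral_congr_ae ?_
      filter_upwards [hsq f g] with ω hω
      rw [hω]
    simp only [← e]
    rfl
  · refine ⟨fun ω => (f : Lp 𝕜 1 P) ω * (g : Lp 𝕜 2 P) ω - L₁ f g ω - L₂ f g ω, ?_⟩
    have hfm : StronglyMeasurable[⨆ n, ℱ n] (f : Lp 𝕜 1 P) := by
      rw [hℱ]; exact Lp.stronglyMeasurable _
    have hgm : StronglyMeasurable[⨆ n, ℱ n] (g : Lp 𝕜 2 P) := by
      rw [hℱ]; exact Lp.stronglyMeasurable _
    filter_upwards [(hL₁ f g).2, (hL₂ f g).2, tendsto_condSeq (hfi f) hfm,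
      tendsto_condSeq ((hg g).integrable one_le_two) hgm] with ω h1 h2 h3 h4
    simp only [sumMul_apply, hd, hp] at h1 h2
    refine ⟨h1, h2, ?_, ?_⟩
    · -- the third series converges because the three partial sums add up to `f_n g_n`
      rw [← tendsto_add_atTop_iff_nat 1] at h1 h2 ⊢
      refine (((h3.mul h4).sub h1).sub h2).congr fun n => ?_
      have := sum_add_sum_add_sum (fun k => condSeq ℱ P (f : Lp 𝕜 1 P) k ω)
        (fun k => condSeq ℱ P (g : Lp 𝕜 2 P) k ω) n
      simp only [← diff_apply] at this
      simp only [← prev_apply] at this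
      linear_combination -this
    · change _ = L₁ f g ω + L₂ f g ω + _
      ring
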